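/- Let $K$ be a field of characteristic zero. Let $A_n$ be the $n$-th Weyl algebra over $K$, generated by $q_1,\dots,q_n,p_1,\dots,p_n$ with defining relations $[p_i,q_j]=\delta_{ij}$, $[p_i,p_j]=[q_i,q_j]=0$, where $[a,b]=ab-ba$. Let $P_m=K[x_{2n+1},\dots,x_{2n+m}]$ be a polynomial algebra, $A:=A_n\otimes_K P_m$, $s:=2n+m$, and write $x_i:=q_i$, $x_{n+i}:=p_i$ for $i=1,\dots,n$, so that the monomials $x^\alpha=x_1^{\alpha_1}\cdots x_s^{\alpha_s}$, $\alpha\in\mathbb N^s$, form a $K$-basis of $A$. For $a=\sum\lambda_\alpha x^\alpha\neq 0$ put $\deg a:=\max\{\alpha_1+\cdots+\alpha_s : \lambda_\alpha\ne 0\}$, and for a $K$-algebra endomorphism $\sigma$ of $A$ put $\deg\sigma:=\max\{\deg\sigma(x_i) : i=1,\dots,s\}$. For $l=1,\dots,m$ let $\frac{\partial}{\partial x_{2n+l}}$ denote the derivation $\mathrm{id}\otimes\frac{\partial}{\partial x_{2n+l}}$ of $A$. Let $\sigma$ be a $K$-algebra endomorphism of $A$ such that $$\Delta:=\det\Big(\frac{\partial\sigma(x_{2n+i})}{\partial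 x_{2n+j}}\Big)_{i,j=1,\dots,m}\in K^*$$ (every endomorphism of $A$ maps the centre $P_m$ of $A$ into itself, so this is the determinant of a matrix over $P_m$). Define derivations $\partial'_1,\dots,\partial'_s$ of $A$ by $$\partial'_i(a):=[\sigma(x_{n+i}),a],\qquad \partial'_{n+i}(a):=-[\sigma(x_i),a]\qquad(i=1,\dots,n),$$ $$\partial'_{2n+j}(a):=\Delta^{-1}\det J_j(a)\qquad(j=1,\dots,m),$$ where $J_j(a)$ is obtained from the Jacobian matrix $\big(\frac{\partial\sigma(x_{2n+k})}{\partial x_{2n+l}}\big)_{k,l}$ by replacing its $j$-th row by $\big(\frac{\partial a}{\partial x_{2n+1}},\dots,\frac{\partial a}{\partial x_{2n+m}}\big)$. Then the following statements are equivalent: 1. $\sigma$ is an automorphism of the $K$-algebra $A$; 2. the derivations $\partial'_1,\dots,\partial'_s$ are locally nilpotent (for all $i$ and all $a\in A$ there is $k\in\mathbb N$ with $(\partial'_i)^k(a)=0$); 3. $(\partial'_i)^{(\deg\sigma)^{s-1}+1}(x_j)=0$ for all $i,j=1,\dots,s$. -/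

import Mathlib

open scoped TensorProduct

namespace WeylPoly

/-- The defining relations of the Weyl algebra on the free algebra with generators
`q_i = ι (inl i)` and `p_i = ι (inr i)`:
`[p_i, q_j] = δ_ij`, `[q_i, q_j] = 0`, `[p_i, p_j] = 0`, where `[a, b] = a * b - b * a`. -/
inductive Rel (K : Type*) [Field K] (n : ℕ) :
    FreeAlgebra K (Fin n ⊕ Fin n) → FreeAlgebra K (Fin n ⊕ Fin n) → Prop
  | pq (i j : Fin n) :
      Rel K n (FreeAlgebra.ι K (Sum.inr i) * FreeAlgebra.ι K (Sum.inl j)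
          - FreeAlgebra.ι K (Sum.inl j) * FreeAlgebra.ι K (Sum.inr i))
        (if i = j then 1 else 0)
  | qq (i j : Fin n) :
      Rel K n (FreeAlgebra.ι K (Sum.inl i) * FreeAlgebra.ι K (Sum.inl j)
          - FreeAlgebra.ι K (Sum.inl j) * FreeAlgebra.ι K (Sum.inl i)) 0
  | pp (i j : Fin n) :
      Rel K n (FreeAlgebra.ι K (Sum.inr i) * FreeAlgebra.ι K (Sum.inr j)
          - FreeAlgebra.ι K (Sum.inr j) * FreeAlgebra.ι K (Sum.inr i)) 0

/-- The `n`-th Weyl algebra `A_n` over `K`, by generators and relations. -/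
def Weyl (K : Type*) [Field K] (n : ℕ) : Type _ := RingQuot (Rel K n)

noncomputable instance (K : Type*) [Field K] (n : ℕ) : Ring (Weyl K n) :=
  inferInstanceAs (Ring (RingQuot (Rel K n)))

noncomputable instance (K : Type*) [Field K] (n : ℕ) : Algebra K (Weyl K n) :=
  inferInstanceAs (Algebra K (RingQuot (Rel K n)))

/-- The quotient map from the free algebra onto `A_n`. -/
noncomputable def Weyl.mk (K : Type*) [Field K] (n : ℕ) :
    FreeAlgebra K (Fin n ⊕ Fin n) →ₐ[K] Weyl K n :=
  RingQuot.mkAlgHom K (Rel K n)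

/-- The generator `q_i` of `A_n`. -/
noncomputable def Weyl.q (K : Type*) [Field K] (n : ℕ) (i : Fin n) : Weyl K n :=
  Weyl.mk K n (FreeAlgebra.ι K (Sum.inl i))

/-- The generator `p_i` of `A_n`. -/
noncomputable def Weyl.p (K : Type*) [Field K] (n : ℕ) (i : Fin n) : Weyl K n :=
  Weyl.mk K n (FreeAlgebra.ι K (Sum.inr i))

/-- The algebra `A = A_n ⊗ P_m`, where `P_m` is the polynomial algebra in `m` variables. -/
abbrev Alg (K : Type*) [Field K] (n m : ℕ) : Type _ :=
  Weyl K n ⊗[K] MvPolynomial (Fin m) K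

/-- The index set `{1, …, s}`, `s = 2n + m`, of the canonical generators, in three blocks:
`i`, `n + i` (for `i = 1, …, n`) and `2n + j` (for `j = 1, …, m`). -/
abbrev Idx (n m : ℕ) : Type := Fin n ⊕ Fin n ⊕ Fin m

/-- The canonical generators of `A`: `x_i = q_i`, `x_{n+i} = p_i`, and `x_{2n+j}` is the `j`-th
variable of `P_m`. -/
noncomputable def x (K : Type*) [Field K] (n m : ℕ) : Idx n m → Alg K n m
  | Sum.inl i => Weyl.q K n i ⊗ₜ[K] 1
  | Sum.inr (Sum.inl i) => Weyl.p K n i ⊗ₜ[K] 1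
  | Sum.inr (Sum.inr j) => 1 ⊗ₜ[K] MvPolynomial.X j

/-- The ordered monomial `x^α = x_1^{α_1} ⋯ x_s^{α_s}`. -/
noncomputable def mono (K : Type*) [Field K] (n m : ℕ) (α : Idx n m → ℕ) : Alg K n m :=
  (List.ofFn fun i : Fin n => x K n m (Sum.inl i) ^ α (Sum.inl i)).prod
    * (List.ofFn fun i : Fin n => x K n m (Sum.inr (Sum.inl i)) ^ α (Sum.inr (Sum.inl i))).prod
    * (List.ofFn fun j : Fin m => x K n m (Sum.inr (Sum.inr j)) ^ α (Sum.inr (Sum.inr j))).prod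

/-- The degree of `a = ∑ λ_α x^α`: the least `d` such that only monomials with `|α| ≤ d` occur
(the monomials `x^α` form a `K`-basis of `A`, so for `a ≠ 0` this is the largest `|α|` with
`λ_α ≠ 0`). -/
noncomputable def deg {K : Type*} [Field K] {n m : ℕ} (a : Alg K n m) : ℕ :=
  sInf {d : ℕ | ∃ c : (Idx n m → ℕ) →₀ K,
    (c.sum fun α k => k • mono K n m α) = a ∧ ∀ α ∈ c.support, ∑ i, α i ≤ d}

/-- The degree of an endomorphism: `deg σ = max_i deg σ(x_i)`. -/
noncomputable def degEnd {K : Type*} [Field K] {n m : ℕ} (σ : Alg K n m →ₐ[K] Alg K n m) : ℕ :=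
  Finset.univ.sup fun i : Idx n m => deg (σ (x K n m i))

/-- The partial derivative `∂_{2n+l} = ∂/∂x_{2n+l}` of `A`, that is, `id ⊗ ∂/∂x_{2n+l}`. -/
noncomputable def pd (K : Type*) [Field K] (n m : ℕ) (l : Fin m) : Alg K n m →ₗ[K] Alg K n m :=
  LinearMap.lTensor (Weyl K n) (MvPolynomial.pderiv (R := K) l).toLinearMap

/-- The determinant of a square matrix by the Leibniz formula, with the factors of each product in
the order of the rows. It is used only for matrices over the (noncommutative) ring `A` in which
all rows except at most one have central entries (an endomorphism of `A` maps the centre `P_m` into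
itself), so that the order of the factors does not matter. -/
def ldet {R : Type*} [Ring R] {m : ℕ} (M : Matrix (Fin m) (Fin m) R) : R :=
  ∑ τ : Equiv.Perm (Fin m), Equiv.Perm.sign τ • (List.ofFn fun i => M i (τ i)).prod

/-- Over a commutative ring `ldet` is the usual determinant. -/
theorem ldet_eq_det {R : Type*} [CommRing R] {m : ℕ} (M : Matrix (Fin m) (Fin m) R) :
    ldet M = M.det := by
  rw [← Matrix.det_transpose, Matrix.det_apply, ldet]
  simp [List.prod_ofFn]

theorem ofFn_updateRow {R : Type*} [Ring R] {m : ℕ} (M : Matrix (Fin m) (Fin m) R) (j : Fin m)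
    (u : Fin m → R) (τ : Equiv.Perm (Fin m)) :
    (fun i => M.updateRow j u i (τ i)) = Function.update (fun i => M i (τ i)) j (u (τ j)) := by
  funext i
  by_cases h : i = j
  · subst h; simp
  · simp [h]

theorem ldet_updateRow_add {R : Type*} [Ring R] {m : ℕ} (M : Matrix (Fin m) (Fin m) R)
    (j : Fin m) (u v : Fin m → R) :
    ldet (M.updateRow j (u + v)) = ldet (M.updateRow j u) + ldet (M.updateRow j v) := by
  unfold ldet
  rw [← Finset.sum_add_distrib]
  refine Finset.sum_congr rfl fun τ _ => ?_
  rw [ofFn_updateRow, ofFn_updateRow, ofFn_updateRow, ← smul_add]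
  have h := (MultilinearMap.mkPiAlgebraFin ℤ m R).map_update_add (fun i => M i (τ i)) j
    (u (τ j)) (v (τ j))
  simp only [MultilinearMap.mkPiAlgebraFin_apply] at h
  rw [Pi.add_apply, h]

theorem ldet_updateRow_smul {K R : Type*} [Field K] [Ring R] [Algebra K R] {m : ℕ}
    (M : Matrix (Fin m) (Fin m) R) (j : Fin m) (c : K) (u : Fin m → R) :
    ldet (M.updateRow j (c • u)) = c • ldet (M.updateRow j u) := by
  unfold ldet
  rw [Finset.smul_sum]
  refine Finset.sum_congr rfl fun τ _ => ?_
  rw [ofFn_updateRow, ofFn_updateRow, smul_comm]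
  have h := (MultilinearMap.mkPiAlgebraFin K m R).map_update_smul (fun i => M i (τ i)) j
    c (u (τ j))
  simp only [MultilinearMap.mkPiAlgebraFin_apply] at h
  rw [Pi.smul_apply, h]

/-- The Jacobian matrix `(∂σ(x_{2n+i}) / ∂x_{2n+j})`, `i, j = 1, …, m`. -/
noncomputable def jac {K : Type*} [Field K] {n m : ℕ} (σ : Alg K n m →ₐ[K] Alg K n m) :
    Matrix (Fin m) (Fin m) (Alg K n m) :=
  Matrix.of fun i j => pd K n m j (σ (x K n m (Sum.inr (Sum.inr i))))

/-- The inner derivation `ad a : b ↦ [a, b] = a * b - b * a`. -/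
noncomputable def ad {K : Type*} [Field K] {n m : ℕ} (a : Alg K n m) :
    Alg K n m →ₗ[K] Alg K n m :=
  LinearMap.mulLeft K a - LinearMap.mulRight K a

/-- `∂'_{2n+j} = Δ⁻¹ det(…)`, where in the Jacobian matrix of `σ` the `j`-th row is replaced by
`(∂/∂x_{2n+1}, …, ∂/∂x_{2n+m})`. Applied to `a ∈ A`, this row is `(∂a/∂x_{2n+1}, …)`. -/
noncomputable def centralPartial {K : Type*} [Field K] {n m : ℕ}
    (σ : Alg K n m →ₐ[K] Alg K n m) (Δ : Kˣ) (j : Fin m) : Alg K n m →ₗ[K] Alg K n m where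
  toFun a := (Δ⁻¹ : Kˣ).val • ldet ((jac σ).updateRow j fun l => pd K n m l a)
  map_add' a b := by
    have h : (fun l => pd K n m l (a + b)) = (fun l => pd K n m l a) + fun l => pd K n m l b := by
      funext l; simp
    rw [h, ldet_updateRow_add, smul_add]
  map_smul' c a := by
    have h : (fun l => pd K n m l (c • a)) = c • fun l => pd K n m l a := by
      funext l; simp
    rw [h, ldet_updateRow_smul, smul_comm, RingHom.id_apply]

/-- The maps `∂'_1, …, ∂'_s` attached to `σ`, where `Δ` is the Jacobian determinant:
`∂'_i = ad σ(x_{n+i})`, `∂'_{n+i} = - ad σ(x_i)`, and `∂'_{2n+j}` as in `centralPartial`. -/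
noncomputable def partial' {K : Type*} [Field K] {n m : ℕ}
    (σ : Alg K n m →ₐ[K] Alg K n m) (Δ : Kˣ) : Idx n m → Alg K n m →ₗ[K] Alg K n m
  | Sum.inl i => ad (σ (x K n m (Sum.inr (Sum.inl i))))
  | Sum.inr (Sum.inl i) => - ad (σ (x K n m (Sum.inl i)))
  | Sum.inr (Sum.inr j) => centralPartial σ Δ j

/-- Local nilpotency: every element is killed by some power of `δ`. -/
def IsLocallyNilpotent {K A : Type*} [Field K] [AddCommGroup A] [Module K A]
    (δ : A →ₗ[K] A) : Prop :=
  ∀ a : A, ∃ k : ℕ, (δ ^ k) a = 0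

end WeylPoly

/-! The algebra A is treated as a filtered deformation of the polynomial ring in s variables. Let
q_i and the central variables act on K[X_1,…,X_s] by multiplication and p_i by X_{n+i} + ∂/∂X_i.
Then x^α sends 1 to X^α, so a ↦ a·1 is a linear isomorphism (`symb`), and it turns [p_i,·], -[q_i,·]
and ∂/∂x_{2n+l} into the ordinary partial derivatives. The symbol of a product is the product of the
symbols up to lower weight, so degrees add.

The main structural fact is that the centralizer of σ(A_n) is P_m (`exists_cen_eq_of_commute`). If c
were a further element of it, the products z^γ c^k σ(x)^β, with z the central and x the noncentral
generators, would be linearly independent. That gives s+1 independent directions of growth, while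
the space of elements of degree at most M has dimension polynomial in M of degree s. Consequently σ
preserves the centre, and its restriction there is a polynomial map with Jacobian Δ.

For 2 ⇒ 1, the kernel of σ is stable under the standard inner derivations and, on the centre, under
the partial derivatives, because ∂'σ = σ∂. Induction on degree makes it zero. For surjectivity,
commuting locally nilpotent derivations with dual slices generate the algebra from the slices and
the constants (`mem_of_slices`). The slices are σ(q_i), σ(p_i) and the constants form P_m. The same
argument on P_m has constants K, so the image of σ contains P_m.

For 1 ⇒ 3, ∂' = σ∂σ⁻¹ (for the central derivations, on the centre), and a partial derivative lowers
degree, so it suffices that deg σ⁻¹ ≤ (deg σ)^{s-1} (`symm_x_mem_afilt`). This is a dimension count: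
requiring σ(a) to have symbol divisible by X_j imposes as many conditions as there are monomials in
the other s-1 variables, and each such a is a multiple of σ⁻¹(x_j). Comparing growth rates bounds
the degree of σ⁻¹(x_j).

Finally 3 ⇒ 2 because nilpotency on generators implies local nilpotency. -/

namespace WeylPoly

/-! ### Polynomials in commuting elements and their commutators. -/

section CommutingFamilies

/-- A pairwise commuting family in an algebra extends to a homomorphism from the polynomial
algebra. -/
theorem exists_algHom_of_commute {K A : Type*} [Field K] [Ring A] [Algebra K A] {ι : Type*}
    (y : ι → A) (hy : ∀ i j, y i * y j = y j * y i) :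
    ∃ h : MvPolynomial ι K →ₐ[K] A, ∀ i, h (MvPolynomial.X i) = y i := by
  let S := Algebra.adjoin K (Set.range y)
  have := Algebra.isMulCommutative_adjoin K (s := Set.range y)
    (by rintro _ ⟨i, rfl⟩ _ ⟨j, rfl⟩; exact hy i j)
  let _ : CommRing S := { (inferInstance : Ring S) with mul_comm := mul_comm' }
  refine ⟨(Algebra.adjoin K (Set.range y)).val.comp
    (MvPolynomial.aeval fun i => ⟨y i, Algebra.subset_adjoin ⟨i, rfl⟩⟩), fun i => ?_⟩
  rw [AlgHom.comp_apply, MvPolynomial.aeval_X]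
  rfl

theorem algHom_monomial_eq_ofFn_prod {K A : Type*} [Field K] [Ring A] [Algebra K A] {r : ℕ}
    (h : MvPolynomial (Fin r) K →ₐ[K] A) (a : Fin r →₀ ℕ) :
    h (MvPolynomial.monomial a 1) = (List.ofFn fun i => h (MvPolynomial.X i) ^ a i).prod := by
  rw [MvPolynomial.monomial_eq, Finsupp.prod_fintype _ _ (fun i => pow_zero _), map_one, one_mul,
    ← List.prod_ofFn, map_list_prod, List.map_ofFn]
  congr 2
  funext i
  simp

/-- If `[p, h X_j] = δ_ij` for all `j` then `[p, h f] = h (∂f/∂X_i)`. -/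
theorem commutator_algHom {K A ι : Type*} [Field K] [Ring A] [Algebra K A] [DecidableEq ι]
    (h : MvPolynomial ι K →ₐ[K] A) (i : ι) (p : A)
    (hp : ∀ j, p * h (MvPolynomial.X j) - h (MvPolynomial.X j) * p = if i = j then 1 else 0)
    (f : MvPolynomial ι K) :
    p * h f - h f * p = h (MvPolynomial.pderiv i f) := by
  induction f using MvPolynomial.induction_on with
  | C a =>
    rw [MvPolynomial.pderiv_C, map_zero, ← MvPolynomial.algebraMap_eq, AlgHom.commutes,
      Algebra.commutes, sub_self]
  | add f g hf hg => rw [map_add, map_add, map_add, ← hf, ← hg]; noncomm_ring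
  | mul_X f j hf =>
    rw [Derivation.leibniz, MvPolynomial.pderiv_X, map_mul, map_add, smul_eq_mul, smul_eq_mul,
      map_mul, map_mul, ← hf]
    have e : h (Pi.single (M := fun _ => MvPolynomial ι K) i 1 j) = if i = j then 1 else 0 := by
      by_cases hij : i = j
      · subst hij; simp
      · rw [Pi.single_eq_of_ne (Ne.symm hij)]; simp [hij]
    -- By induction the commutator lies in the image of a commutative ring, hence commutes with `h
    -- (X j)`.
    have e2 : h (MvPolynomial.X j) * (p * h f - h f * p)
        = (p * h f - h f * p) * h (MvPolynomial.X j) := by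
      rw [hf, ← map_mul, ← map_mul, mul_comm]
    rw [e, ← hp j, e2]
    noncomm_ring

/-- If `[h X_j, q] = δ_ij` for all `j` then `[h f, q] = h (∂f/∂X_i)`. -/
theorem commutator_algHom' {K A ι : Type*} [Field K] [Ring A] [Algebra K A] [DecidableEq ι]
    (h : MvPolynomial ι K →ₐ[K] A) (i : ι) (q : A)
    (hq : ∀ j, h (MvPolynomial.X j) * q - q * h (MvPolynomial.X j) = if i = j then 1 else 0)
    (f : MvPolynomial ι K) :
    h f * q - q * h f = h (MvPolynomial.pderiv i f) := by
  rw [← commutator_algHom h i (-q) (fun j => by rw [← hq j]; noncomm_ring) f]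
  noncomm_ring

theorem mul_mul_mul_eq_commutator_add {R : Type*} [Ring R] (p f g h : R) :
    p * (f * g * h) = (p * f - f * p) * g * h + f * (p * g) * h := by
  noncomm_ring

end CommutingFamilies

/-! ### Relations and generators of A. -/

section Relations

variable (K : Type*) [Field K] (n m : ℕ)

theorem Weyl.rel_pq (i j : Fin n) :
    Weyl.p K n i * Weyl.q K n j - Weyl.q K n j * Weyl.p K n i = if i = j then 1 else 0 := by
  have h := RingQuot.mkAlgHom_rel K (Rel.pq (K := K) (n := n) i j)
  change Weyl.mk K n _ = Weyl.mk K n _ at h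
  rw [map_sub, map_mul, map_mul] at h
  rw [Weyl.p, Weyl.q, h]
  split_ifs <;> simp

theorem Weyl.rel_qq (i j : Fin n) :
    Weyl.q K n i * Weyl.q K n j = Weyl.q K n j * Weyl.q K n i := by
  have h := RingQuot.mkAlgHom_rel K (Rel.qq (K := K) (n := n) i j)
  change Weyl.mk K n _ = Weyl.mk K n _ at h
  rw [map_sub, map_mul, map_mul, map_zero, sub_eq_zero] at h
  exact h

theorem Weyl.rel_pp (i j : Fin n) :
    Weyl.p K n i * Weyl.p K n j = Weyl.p K n j * Weyl.p K n i := by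
  have h := RingQuot.mkAlgHom_rel K (Rel.pp (K := K) (n := n) i j)
  change Weyl.mk K n _ = Weyl.mk K n _ at h
  rw [map_sub, map_mul, map_mul, map_zero, sub_eq_zero] at h
  exact h

theorem Weyl.mk_surjective : Function.Surjective (Weyl.mk K n) :=
  RingQuot.mkAlgHom_surjective K (Rel K n)

theorem Weyl.adjoin_eq_top :
    Algebra.adjoin K (Set.range (Weyl.q K n) ∪ Set.range (Weyl.p K n)) = ⊤ := by
  rw [eq_top_iff]
  rintro a -
  obtain ⟨f, rfl⟩ := Weyl.mk_surjective K n a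
  induction f using FreeAlgebra.induction with
  | grade0 r => rw [AlgHom.commutes]; exact Subalgebra.algebraMap_mem _ r
  | grade1 i =>
    refine Algebra.subset_adjoin ?_
    rcases i with i | i
    · exact Or.inl ⟨i, rfl⟩
    · exact Or.inr ⟨i, rfl⟩
  | mul a b ha hb => rw [map_mul]; exact mul_mem ha hb
  | add a b ha hb => rw [map_add]; exact add_mem ha hb

variable {K n m}

/-- The index of `q_i`. -/
abbrev iq (i : Fin n) : Idx n m := Sum.inl i
/-- The index of `p_i`. -/
abbrev ip (i : Fin n) : Idx n m := Sum.inr (Sum.inl i)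
/-- The index of the `l`-th central variable. -/
abbrev iz (l : Fin m) : Idx n m := Sum.inr (Sum.inr l)

/-- The embedding of `P_m` in `A`. -/
noncomputable abbrev cen (K : Type*) [Field K] (n m : ℕ) : MvPolynomial (Fin m) K →ₐ[K] Alg K n m :=
  Algebra.TensorProduct.includeRight

theorem x_pq (i j : Fin n) :
    x K n m (ip i) * x K n m (iq j) - x K n m (iq j) * x K n m (ip i) = if i = j then 1 else 0 := by
  simp only [x, Algebra.TensorProduct.tmul_mul_tmul, mul_one, ← TensorProduct.sub_tmul,
    Weyl.rel_pq]
  split_ifs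
  · rfl
  · simp

theorem x_qq (i j : Fin n) :
    x K n m (iq i) * x K n m (iq j) = x K n m (iq j) * x K n m (iq i) := by
  simp only [x, Algebra.TensorProduct.tmul_mul_tmul, mul_one, Weyl.rel_qq K n i j]

theorem x_pp (i j : Fin n) :
    x K n m (ip i) * x K n m (ip j) = x K n m (ip j) * x K n m (ip i) := by
  simp only [x, Algebra.TensorProduct.tmul_mul_tmul, mul_one, Weyl.rel_pp K n i j]

theorem cen_commutes (f : MvPolynomial (Fin m) K) (a : Alg K n m) : cen K n m f * a = a * cen K n m f := by
  induction a using TensorProduct.induction_on with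
  | zero => simp
  | tmul w g => simp [mul_comm]
  | add a b ha hb => rw [mul_add, add_mul, ha, hb]

theorem cen_X (l : Fin m) : cen K n m (MvPolynomial.X l) = x K n m (iz l) := rfl

theorem adjoin_x_eq_top : Algebra.adjoin K (Set.range (x K n m)) = ⊤ := by
  rw [eq_top_iff]
  rintro a -
  have hw : ∀ w : Weyl K n, w ⊗ₜ[K] (1 : MvPolynomial (Fin m) K) ∈
      Algebra.adjoin K (Set.range (x K n m)) := by
    intro w
    have hle : Algebra.adjoin K (Set.range (Weyl.q K n) ∪ Set.range (Weyl.p K n)) ≤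
        (Algebra.adjoin K (Set.range (x K n m))).comap
          (Algebra.TensorProduct.includeLeft (R := K) (S := K)) := by
      refine Algebra.adjoin_le ?_
      rintro _ (⟨i, rfl⟩ | ⟨i, rfl⟩)
      · exact Algebra.subset_adjoin ⟨iq i, rfl⟩
      · exact Algebra.subset_adjoin ⟨ip i, rfl⟩
    rw [Weyl.adjoin_eq_top] at hle
    exact hle (Algebra.mem_top (x := w))
  have hf : ∀ f : MvPolynomial (Fin m) K, cen K n m f ∈ Algebra.adjoin K (Set.range (x K n m)) := by
    intro f
    have hle : Algebra.adjoin K (Set.range (MvPolynomial.X : Fin m → MvPolynomial (Fin m) K)) ≤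
        (Algebra.adjoin K (Set.range (x K n m))).comap (cen K n m) := by
      refine Algebra.adjoin_le ?_
      rintro _ ⟨i, rfl⟩
      exact Algebra.subset_adjoin ⟨iz i, rfl⟩
    rw [MvPolynomial.adjoin_range_X] at hle
    exact hle (Algebra.mem_top (x := f))
  induction a using TensorProduct.induction_on with
  | zero => exact zero_mem _
  | tmul w g =>
    have := mul_mem (hw w) (hf g)
    simpa using this
  | add a b ha hb => exact add_mem ha hb

end Relations

/-! ### The ordered monomials span A. -/

section NormalForm

variable (K : Type*) [Field K] (n m : ℕ)

/-- Polynomials in the `q_i`. -/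
noncomputable def hq : MvPolynomial (Fin n) K →ₐ[K] Alg K n m :=
  (exists_algHom_of_commute (fun i => x K n m (iq i)) fun i j => x_qq i j).choose

/-- Polynomials in the `p_i`. -/
noncomputable def hp : MvPolynomial (Fin n) K →ₐ[K] Alg K n m :=
  (exists_algHom_of_commute (fun i => x K n m (ip i)) fun i j => x_pp i j).choose

variable {K n m}

@[simp] theorem hq_X (i : Fin n) : hq K n m (MvPolynomial.X i) = x K n m (iq i) :=
  (exists_algHom_of_commute (fun i => x K n m (iq i)) fun i j => x_qq i j).choose_spec i

@[simp] theorem hp_X (i : Fin n) : hp K n m (MvPolynomial.X i) = x K n m (ip i) :=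
  (exists_algHom_of_commute (fun i => x K n m (ip i)) fun i j => x_pp i j).choose_spec i

theorem p_commutator_hq (i : Fin n) (f : MvPolynomial (Fin n) K) :
    x K n m (ip i) * hq K n m f - hq K n m f * x K n m (ip i)
      = hq K n m (MvPolynomial.pderiv i f) :=
  commutator_algHom _ i _ (fun j => by rw [hq_X, x_pq]) f

theorem q_commutator_hp (i : Fin n) (f : MvPolynomial (Fin n) K) :
    hp K n m f * x K n m (iq i) - x K n m (iq i) * hp K n m f
      = hp K n m (MvPolynomial.pderiv i f) :=
  commutator_algHom' _ i _ (fun j => by rw [hp_X, x_pq]; simp only [eq_comm]) f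

/-- The `q`-part of an exponent vector. -/
noncomputable def expQ (α : Idx n m → ℕ) : Fin n →₀ ℕ :=
  Finsupp.equivFunOnFinite.symm fun i => α (iq i)
/-- The `p`-part of an exponent vector. -/
noncomputable def expP (α : Idx n m → ℕ) : Fin n →₀ ℕ :=
  Finsupp.equivFunOnFinite.symm fun i => α (ip i)
/-- The central part of an exponent vector. -/
noncomputable def expZ (α : Idx n m → ℕ) : Fin m →₀ ℕ :=
  Finsupp.equivFunOnFinite.symm fun i => α (iz i)

theorem mono_eq (α : Idx n m → ℕ) :
    mono K n m α = hq K n m (MvPolynomial.monomial (expQ α) 1)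
      * hp K n m (MvPolynomial.monomial (expP α) 1) * cen K n m (MvPolynomial.monomial (expZ α) 1) := by
  simp only [algHom_monomial_eq_ofFn_prod, mono, hq_X, hp_X, cen_X]
  rfl

theorem exists_mono_eq (a b : Fin n →₀ ℕ) (c : Fin m →₀ ℕ) :
    ∃ α : Idx n m → ℕ, expQ α = a ∧ expP α = b ∧ expZ α = c :=
  ⟨Sum.elim a (Sum.elim b c), by ext; rfl, by ext; rfl, by ext; rfl⟩

/-- The span of the monomials contains all ordered products. -/
theorem ordered_mem_span (f g : MvPolynomial (Fin n) K) (h : MvPolynomial (Fin m) K) :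
    hq K n m f * hp K n m g * cen K n m h ∈ Submodule.span K (Set.range (mono K n m)) := by
  have hspan : ∀ {r : ℕ} (φ : MvPolynomial (Fin r) K →ₐ[K] Alg K n m) (f),
      φ f ∈ Submodule.span K (Set.range fun a => φ (MvPolynomial.monomial a 1)) := by
    intro r φ f
    rw [f.as_sum, map_sum]
    refine Submodule.sum_mem _ fun a _ => ?_
    have : MvPolynomial.monomial a (f.coeff a) = f.coeff a • MvPolynomial.monomial a (1 : K) := by
      rw [MvPolynomial.smul_monomial, smul_eq_mul, mul_one]
    rw [this, map_smul]
    exact Submodule.smul_mem _ _ (Submodule.subset_span ⟨a, rfl⟩)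
  have := Submodule.mul_mem_mul (Submodule.mul_mem_mul (hspan (hq K n m) f) (hspan (hp K n m) g))
    (hspan (cen K n m) h)
  rw [Submodule.span_mul_span, Submodule.span_mul_span] at this
  refine Submodule.span_mono ?_ this
  rintro _ ⟨_, ⟨_, ⟨a, rfl⟩, _, ⟨b, rfl⟩, rfl⟩, _, ⟨c, rfl⟩, rfl⟩
  obtain ⟨α, rfl, rfl, rfl⟩ := exists_mono_eq a b c
  exact ⟨α, mono_eq α⟩

/-- The span contains 1 and is stable under left multiplication by generators. Only p_i is out of
place, and moving it past a polynomial in the q's costs a partial derivative, which is again an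
ordered product. -/
theorem span_mono_eq_top : Submodule.span K (Set.range (mono K n m)) = ⊤ := by
  have key : ∀ a ∈ Algebra.adjoin K (Set.range (x K n m)),
      ∀ b ∈ Submodule.span K (Set.range (mono K n m)),
        a * b ∈ Submodule.span K (Set.range (mono K n m)) := by
    intro a ha
    induction ha using Algebra.adjoin_induction with
    | mem y hy =>
      obtain ⟨i, rfl⟩ := hy
      intro b hb
      induction hb using Submodule.span_induction with
      | mem b hb =>
        obtain ⟨α, rfl⟩ := hb
        rw [mono_eq]
        generalize MvPolynomial.monomial (expQ α) (1 : K) = f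
        generalize MvPolynomial.monomial (expP α) (1 : K) = g
        generalize MvPolynomial.monomial (expZ α) (1 : K) = h
        rcases i with i | i | i
        · have := ordered_mem_span (n := n) (m := m) (MvPolynomial.X i * f) g h
          rwa [map_mul, hq_X, mul_assoc, mul_assoc, ← mul_assoc (hq K n m f)] at this
        · have e : x K n m (ip i) * (hq K n m f * hp K n m g * cen K n m h)
              = hq K n m (MvPolynomial.pderiv i f) * hp K n m g * cen K n m h
                + hq K n m f * hp K n m (MvPolynomial.X i * g) * cen K n m h := by
            rw [← p_commutator_hq, map_mul, hp_X]; exact mul_mul_mul_eq_commutator_add _ _ _ _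
          rw [e]
          exact add_mem (ordered_mem_span _ _ _) (ordered_mem_span _ _ _)
        · have e : x K n m (iz i) * (hq K n m f * hp K n m g * cen K n m h)
              = hq K n m f * hp K n m g * cen K n m (MvPolynomial.X i * h) := by
            rw [← cen_X, cen_commutes, mul_assoc, ← map_mul, mul_comm h]
          rw [e]
          exact ordered_mem_span _ _ _
      | zero => rw [mul_zero]; exact zero_mem _
      | add b c _ _ hb hc => rw [mul_add]; exact add_mem hb hc
      | smul r b _ hb => rw [mul_smul_comm]; exact Submodule.smul_mem _ _ hb
    | algebraMap r =>
      intro b hb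
      rw [← Algebra.smul_def]
      exact Submodule.smul_mem _ _ hb
    | add a a' _ _ ha ha' => intro b hb; rw [add_mul]; exact add_mem (ha b hb) (ha' b hb)
    | mul a a' _ _ ha ha' => intro b hb; rw [mul_assoc]; exact ha _ (ha' b hb)
  rw [eq_top_iff]
  rintro a -
  have h1 : (1 : Alg K n m) ∈ Submodule.span K (Set.range (mono K n m)) := by
    have := ordered_mem_span (n := n) (m := m) (1 : MvPolynomial (Fin n) K) 1 1
    rwa [map_one, map_one, map_one, mul_one, mul_one] at this
  have := key a (by rw [adjoin_x_eq_top]; exact Algebra.mem_top) 1 h1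
  rwa [mul_one] at this

end NormalForm

/-! ### The polynomial representation and the symbol isomorphism. -/

section Symbol

variable (K : Type*) [Field K] (n m : ℕ)

/-- Partial derivatives of polynomials commute. -/
theorem pderiv_comm {ι : Type*} (i j : ι) (f : MvPolynomial ι K) :
    MvPolynomial.pderiv i (MvPolynomial.pderiv j f)
      = MvPolynomial.pderiv j (MvPolynomial.pderiv i f) := by
  classical
  have h : ⁅MvPolynomial.pderiv (R := K) i, MvPolynomial.pderiv (R := K) j⁆ = 0 := by
    apply MvPolynomial.derivation_ext
    intro k
    rw [Derivation.commutator_apply, MvPolynomial.pderiv_X, MvPolynomial.pderiv_X]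
    by_cases h1 : k = i <;> by_cases h2 : k = j <;>
      simp [Pi.single_apply, h1, h2, apply_ite]
  have h2 := congrArg (fun D => D f) h
  simpa [Derivation.commutator_apply, sub_eq_zero] using h2

/-- The action of `A_n` on polynomials in which `q_i` acts by multiplication and `p_i` by
`X_{n+i} + ∂/∂X_i`. -/
noncomputable def weylRep :
    Weyl K n →ₐ[K] Module.End K (MvPolynomial (Idx n m) K) :=
  RingQuot.liftAlgHom K ⟨FreeAlgebra.lift K (Sum.elim
    (fun i => Algebra.lmul K (MvPolynomial (Idx n m) K) (MvPolynomial.X (iq i)))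
    (fun i => Algebra.lmul K (MvPolynomial (Idx n m) K) (MvPolynomial.X (ip i))
      + (MvPolynomial.pderiv (R := K) (iq i : Idx n m)).toLinearMap)), by
    intro a b hab
    induction hab with
    | pq i j =>
      refine LinearMap.ext fun f => ?_
      have hX : MvPolynomial.pderiv (R := K) (iq i : Idx n m) (MvPolynomial.X (iq j))
          = if i = j then 1 else 0 := by
        rw [MvPolynomial.pderiv_X]
        by_cases h : i = j
        · subst h; simp
        · simp [h, Ne.symm h]
      rw [map_sub, map_mul, map_mul, FreeAlgebra.lift_ι_apply, FreeAlgebra.lift_ι_apply]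
      have hite : (FreeAlgebra.lift K (Sum.elim
          (fun i => Algebra.lmul K (MvPolynomial (Idx n m) K) (MvPolynomial.X (iq i)))
          (fun i => Algebra.lmul K (MvPolynomial (Idx n m) K) (MvPolynomial.X (ip i))
            + (MvPolynomial.pderiv (R := K) (iq i : Idx n m)).toLinearMap)))
            (if i = j then 1 else 0) f = (if i = j then 1 else 0) * f := by
        split_ifs <;> simp
      rw [hite, ← hX]
      simp only [Sum.elim_inr, Sum.elim_inl, LinearMap.sub_apply, Module.End.mul_apply,
        LinearMap.add_apply,
        LinearMap.mul_apply', Algebra.coe_lmul_eq_mul, Derivation.coeFn_coe, Derivation.leibniz,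
        smul_eq_mul]
      ring
    | qq i j =>
      refine LinearMap.ext fun f => ?_
      rw [map_sub, map_mul, map_mul, FreeAlgebra.lift_ι_apply, FreeAlgebra.lift_ι_apply]
      simp only [Sum.elim_inl, LinearMap.sub_apply, Module.End.mul_apply,
        LinearMap.mul_apply', Algebra.coe_lmul_eq_mul, map_zero, LinearMap.zero_apply]
      ring
    | pp i j =>
      refine LinearMap.ext fun f => ?_
      rw [map_sub, map_mul, map_mul, FreeAlgebra.lift_ι_apply, FreeAlgebra.lift_ι_apply]
      simp only [Sum.elim_inr, LinearMap.sub_apply, Module.End.mul_apply, LinearMap.add_apply,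
        LinearMap.mul_apply', Algebra.coe_lmul_eq_mul, map_zero, LinearMap.zero_apply,
        Derivation.coeFn_coe, Derivation.leibniz, smul_eq_mul, map_add]
      rw [pderiv_comm K (iq j) (iq i), MvPolynomial.pderiv_X_of_ne (by simp),
        MvPolynomial.pderiv_X_of_ne (by simp)]
      ring⟩

theorem weylRep_q (i : Fin n) : weylRep K n m (Weyl.q K n i)
    = Algebra.lmul K (MvPolynomial (Idx n m) K) (MvPolynomial.X (iq i)) := by
  refine (RingQuot.liftAlgHom_mkAlgHom_apply K _ _ _).trans ?_
  rw [FreeAlgebra.lift_ι_apply]; rfl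

theorem weylRep_p (i : Fin n) : weylRep K n m (Weyl.p K n i)
    = Algebra.lmul K (MvPolynomial (Idx n m) K) (MvPolynomial.X (ip i))
      + (MvPolynomial.pderiv (R := K) (iq i : Idx n m)).toLinearMap := by
  refine (RingQuot.liftAlgHom_mkAlgHom_apply K _ _ _).trans ?_
  rw [FreeAlgebra.lift_ι_apply]; rfl

/-- The action of `P_m` by multiplication. -/
noncomputable def polyRep :
    MvPolynomial (Fin m) K →ₐ[K] Module.End K (MvPolynomial (Idx n m) K) :=
  (Algebra.lmul K (MvPolynomial (Idx n m) K)).comp (MvPolynomial.rename iz)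

theorem polyRep_apply (f : MvPolynomial (Fin m) K) (g : MvPolynomial (Idx n m) K) :
    polyRep K n m f g = MvPolynomial.rename iz f * g := rfl

theorem pderiv_rename_eq_zero {ι κ : Type*} (e : κ → ι) (i : ι) (h : ∀ k, e k ≠ i)
    (f : MvPolynomial κ K) : MvPolynomial.pderiv i (MvPolynomial.rename e f) = 0 := by
  induction f using MvPolynomial.induction_on with
  | C a => simp
  | add f g hf hg => rw [map_add, map_add, hf, hg, add_zero]
  | mul_X f k hf =>
    rw [map_mul, Derivation.leibniz, hf, MvPolynomial.rename_X,
      MvPolynomial.pderiv_X_of_ne (h k), smul_zero, smul_zero, add_zero]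

theorem weylRep_commute_polyRep (a : Weyl K n) (f : MvPolynomial (Fin m) K) :
    Commute (weylRep K n m a) (polyRep K n m f) := by
  have h : ⊤ ≤ (Subalgebra.centralizer K {polyRep K n m f}).comap (weylRep K n m) := by
    rw [← Weyl.adjoin_eq_top]
    refine Algebra.adjoin_le ?_
    rintro _ (⟨i, rfl⟩ | ⟨i, rfl⟩)
    · rw [SetLike.mem_coe, Subalgebra.mem_comap, Subalgebra.mem_centralizer_iff]
      rintro _ rfl
      rw [weylRep_q]
      refine LinearMap.ext fun g => ?_
      simp only [Module.End.mul_apply, polyRep_apply, Algebra.coe_lmul_eq_mul,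
        LinearMap.mul_apply']
      ring
    · rw [SetLike.mem_coe, Subalgebra.mem_comap, Subalgebra.mem_centralizer_iff]
      rintro _ rfl
      rw [weylRep_p]
      refine LinearMap.ext fun g => ?_
      simp only [Module.End.mul_apply, polyRep_apply, Algebra.coe_lmul_eq_mul,
        LinearMap.mul_apply', LinearMap.add_apply, Derivation.coeFn_coe, Derivation.leibniz,
        smul_eq_mul]
      rw [pderiv_rename_eq_zero K _ _ (by simp)]
      ring
  have h2 := h (Algebra.mem_top (x := a))
  rw [Subalgebra.mem_comap, Subalgebra.mem_centralizer_iff] at h2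
  exact (h2 _ rfl).symm

/-- The action of `A` on polynomials; `a` is recovered from `a • 1`, see `symb`. -/
noncomputable def rep : Alg K n m →ₐ[K] Module.End K (MvPolynomial (Idx n m) K) :=
  Algebra.TensorProduct.lift (weylRep K n m) (polyRep K n m) (weylRep_commute_polyRep K n m)

variable {K n m}

theorem rep_q (i : Fin n) (g : MvPolynomial (Idx n m) K) :
    rep K n m (x K n m (iq i)) g = MvPolynomial.X (iq i) * g := by
  simp [rep, x, weylRep_q]

theorem rep_p (i : Fin n) (g : MvPolynomial (Idx n m) K) :
    rep K n m (x K n m (ip i)) g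
      = MvPolynomial.X (ip i) * g + MvPolynomial.pderiv (iq i) g := by
  simp [rep, x, weylRep_p]

theorem rep_cen (f : MvPolynomial (Fin m) K) (g : MvPolynomial (Idx n m) K) :
    rep K n m (cen K n m f) g = MvPolynomial.rename iz f * g := by
  simp [rep, polyRep_apply]

theorem rep_hq (f : MvPolynomial (Fin n) K) (g : MvPolynomial (Idx n m) K) :
    rep K n m (hq K n m f) g = MvPolynomial.rename iq f * g := by
  have h : (rep K n m).comp (hq K n m)
      = (Algebra.lmul K (MvPolynomial (Idx n m) K)).comp (MvPolynomial.rename iq) := by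
    apply MvPolynomial.algHom_ext
    intro i
    refine LinearMap.ext fun g => ?_
    rw [AlgHom.comp_apply, hq_X, rep_q]
    simp
  exact congrArg (fun F => F f g) h

/-- On polynomials free of the q-variables the derivative part of p_i vanishes, and multiplication
by X_{n+i} preserves this freeness. In an ordered product applied to 1 the p's act before the q's,
so they meet only such polynomials. -/
theorem rep_hp (f : MvPolynomial (Fin n) K) (g : MvPolynomial (Idx n m) K)
    (hg : ∀ i : Fin n, MvPolynomial.pderiv (iq i) g = 0) :
    rep K n m (hp K n m f) g = MvPolynomial.rename ip f * g := by
  induction f using MvPolynomial.induction_on generalizing g with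
  | C a =>
    rw [← MvPolynomial.algebraMap_eq, AlgHom.commutes, AlgHom.commutes, AlgHom.commutes,
      Module.algebraMap_end_apply, Algebra.smul_def]
  | add f f' hf hf' =>
    rw [map_add, map_add, map_add, LinearMap.add_apply, hf g hg, hf' g hg, add_mul]
  | mul_X f i hf =>
    rw [map_mul, map_mul, Module.End.mul_apply, hp_X, rep_p, hg, add_zero, hf, map_mul,
      MvPolynomial.rename_X, mul_assoc]
    intro j
    rw [Derivation.leibniz, hg, MvPolynomial.pderiv_X_of_ne (by simp), smul_zero, smul_zero,
      add_zero]

theorem rep_ordered (f g : MvPolynomial (Fin n) K) (h : MvPolynomial (Fin m) K) :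
    rep K n m (hq K n m f * hp K n m g * cen K n m h) 1
      = MvPolynomial.rename iq f * MvPolynomial.rename ip g * MvPolynomial.rename iz h := by
  rw [map_mul, map_mul, Module.End.mul_apply, Module.End.mul_apply, rep_cen, rep_hp, rep_hq,
    mul_one, mul_assoc]
  intro i
  rw [mul_one, pderiv_rename_eq_zero K _ _ (by simp)]

theorem rename_monomial_mul (α : Idx n m →₀ ℕ) :
    MvPolynomial.rename iq (MvPolynomial.monomial (expQ α) (1 : K))
      * MvPolynomial.rename ip (MvPolynomial.monomial (expP α) (1 : K))
      * MvPolynomial.rename iz (MvPolynomial.monomial (expZ α) (1 : K))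
      = MvPolynomial.monomial α 1 := by
  rw [MvPolynomial.rename_monomial, MvPolynomial.rename_monomial, MvPolynomial.rename_monomial,
    MvPolynomial.monomial_mul, MvPolynomial.monomial_mul, one_mul]
  have i1 : Function.Injective (iq : Fin n → Idx n m) := Sum.inl_injective
  have i2 : Function.Injective (ip : Fin n → Idx n m) := Sum.inr_injective.comp Sum.inl_injective
  have i3 : Function.Injective (iz : Fin m → Idx n m) := Sum.inr_injective.comp Sum.inr_injective
  suffices e : Finsupp.mapDomain iq (expQ α) + Finsupp.mapDomain ip (expP α)
      + Finsupp.mapDomain iz (expZ α) = α by rw [e, one_mul]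
  refine Finsupp.ext ?_
  rintro (i | i | i)
  · rw [Finsupp.add_apply, Finsupp.add_apply]
    erw [Finsupp.mapDomain_apply i1]
    rw [Finsupp.mapDomain_of_notMem_range _ _ (by simp), Finsupp.mapDomain_of_notMem_range _ _ (by simp),
      add_zero, add_zero]
    rfl
  · rw [Finsupp.add_apply, Finsupp.add_apply]
    erw [Finsupp.mapDomain_apply i2]
    rw [Finsupp.mapDomain_of_notMem_range _ _ (by simp), Finsupp.mapDomain_of_notMem_range _ _ (by simp),
      zero_add, add_zero]
    rfl
  · rw [Finsupp.add_apply, Finsupp.add_apply]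
    erw [Finsupp.mapDomain_apply i3]
    rw [Finsupp.mapDomain_of_notMem_range _ _ (by simp), Finsupp.mapDomain_of_notMem_range _ _ (by simp),
      zero_add, zero_add]
    rfl

theorem rep_mono (α : Idx n m →₀ ℕ) :
    rep K n m (mono K n m α) 1 = MvPolynomial.monomial α 1 := by
  rw [mono_eq, rep_ordered, rename_monomial_mul]

variable (K n m) in
/-- Normal ordering, the linear map `X^α ↦ x^α`. -/
noncomputable def normalOrder : MvPolynomial (Idx n m) K →ₗ[K] Alg K n m :=
  (MvPolynomial.basisMonomials (Idx n m) K).constr K fun α => mono K n m α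

theorem normalOrder_monomial (α : Idx n m →₀ ℕ) :
    normalOrder K n m (MvPolynomial.monomial α 1) = mono K n m α := by
  exact (MvPolynomial.basisMonomials (Idx n m) K).constr_basis K _ α

/-- This left inverse of normal ordering is what proves the ordered monomials linearly independent.
-/
theorem rep_normalOrder (f : MvPolynomial (Idx n m) K) :
    rep K n m (normalOrder K n m f) 1 = f := by
  have h : (LinearMap.applyₗ 1 ∘ₗ (rep K n m).toLinearMap) ∘ₗ normalOrder K n m
      = LinearMap.id := by
    refine (MvPolynomial.basisMonomials (Idx n m) K).ext fun α => ?_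
    rw [MvPolynomial.coe_basisMonomials, LinearMap.comp_apply, normalOrder_monomial]
    exact rep_mono α
  exact congrArg (fun F => F f) h

theorem normalOrder_surjective : Function.Surjective (normalOrder K n m) := by
  rw [← LinearMap.range_eq_top, eq_top_iff, ← span_mono_eq_top, Submodule.span_le]
  rintro _ ⟨α, rfl⟩
  exact ⟨MvPolynomial.monomial (Finsupp.equivFunOnFinite.symm α) 1, normalOrder_monomial _⟩

variable (K n m) in
/-- The symbol of an element of `A`: the linear isomorphism `x^α ↦ X^α`. -/
noncomputable def symb : Alg K n m ≃ₗ[K] MvPolynomial (Idx n m) K :=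
  (LinearEquiv.ofBijective (normalOrder K n m)
    ⟨Function.LeftInverse.injective (g := fun a => rep K n m a 1) rep_normalOrder,
      normalOrder_surjective⟩).symm

theorem symb_normalOrder (f : MvPolynomial (Idx n m) K) :
    symb K n m (normalOrder K n m f) = f :=
  LinearEquiv.ofBijective_symm_apply_apply (normalOrder K n m) f

theorem normalOrder_symb (a : Alg K n m) : normalOrder K n m (symb K n m a) = a :=
  LinearEquiv.apply_ofBijective_symm_apply (normalOrder K n m) a

theorem symb_eq_rep (a : Alg K n m) : symb K n m a = rep K n m a 1 := by
  rw [← rep_normalOrder (symb K n m a), normalOrder_symb]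

theorem symb_mul (a b : Alg K n m) : symb K n m (a * b) = rep K n m a (symb K n m b) := by
  rw [symb_eq_rep, symb_eq_rep, map_mul, Module.End.mul_apply]

theorem symb_one : symb K n m 1 = 1 := by
  rw [symb_eq_rep, map_one (rep K n m), Module.End.one_apply]

theorem symb_mono (α : Idx n m →₀ ℕ) : symb K n m (mono K n m α) = MvPolynomial.monomial α 1 := by
  rw [symb_eq_rep, rep_mono]

theorem symb_cen (f : MvPolynomial (Fin m) K) :
    symb K n m (cen K n m f) = MvPolynomial.rename iz f := by
  rw [symb_eq_rep, rep_cen, mul_one]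

theorem symb_x (i : Idx n m) : symb K n m (x K n m i) = MvPolynomial.X i := by
  rcases i with i | i | i
  · rw [symb_eq_rep, rep_q, mul_one]
  · rw [symb_eq_rep, rep_p, mul_one, MvPolynomial.pderiv_one, add_zero]
  · rw [← cen_X, symb_cen, MvPolynomial.rename_X]

theorem normalOrder_ordered (f g : MvPolynomial (Fin n) K) (h : MvPolynomial (Fin m) K) :
    normalOrder K n m (MvPolynomial.rename iq f * MvPolynomial.rename ip g
      * MvPolynomial.rename iz h) = hq K n m f * hp K n m g * cen K n m h := by
  rw [← rep_ordered, ← symb_eq_rep, normalOrder_symb]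

/-- Linear maps out of the polynomial ring agree if they agree on products. -/
theorem linearMap_ext_ordered {M : Type*} [AddCommMonoid M] [Module K M]
    {F G : MvPolynomial (Idx n m) K →ₗ[K] M}
    (h : ∀ (f g : MvPolynomial (Fin n) K) (h : MvPolynomial (Fin m) K),
      F (MvPolynomial.rename iq f * MvPolynomial.rename ip g * MvPolynomial.rename iz h)
        = G (MvPolynomial.rename iq f * MvPolynomial.rename ip g * MvPolynomial.rename iz h)) :
    F = G := by
  refine (MvPolynomial.basisMonomials (Idx n m) K).ext fun α => ?_
  rw [MvPolynomial.coe_basisMonomials]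
  beta_reduce
  rw [← rename_monomial_mul]
  exact h _ _ _

/-- `X_j f` is normally ordered as `x_j * _` if `x_j` is some `q_i`. -/
theorem normalOrder_q_mul (i : Fin n) (f : MvPolynomial (Idx n m) K) :
    normalOrder K n m (MvPolynomial.X (iq i) * f) = x K n m (iq i) * normalOrder K n m f := by
  have h : normalOrder K n m ∘ₗ LinearMap.mulLeft K (MvPolynomial.X (iq i))
      = LinearMap.mulLeft K (x K n m (iq i)) ∘ₗ normalOrder K n m := by
    refine linearMap_ext_ordered fun f g h => ?_
    rw [LinearMap.comp_apply, LinearMap.comp_apply, LinearMap.mulLeft_apply,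
      LinearMap.mulLeft_apply, normalOrder_ordered, ← MvPolynomial.rename_X (f := iq), ← mul_assoc,
      ← mul_assoc, ← map_mul, normalOrder_ordered, map_mul, hq_X, mul_assoc, mul_assoc, mul_assoc]
  exact congrArg (fun F => F f) h

/-- `X_j f` is normally ordered as `_ * x_j` if `x_j` is some `p_i` or is central. -/
theorem normalOrder_mul (i : Fin n ⊕ Fin m) (f : MvPolynomial (Idx n m) K) :
    normalOrder K n m (MvPolynomial.X (Sum.inr i) * f)
      = normalOrder K n m f * x K n m (Sum.inr i) := by
  have h : normalOrder K n m ∘ₗ LinearMap.mulLeft K (MvPolynomial.X (Sum.inr i))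
      = LinearMap.mulRight K (x K n m (Sum.inr i)) ∘ₗ normalOrder K n m := by
    refine linearMap_ext_ordered fun f g h => ?_
    rw [LinearMap.comp_apply, LinearMap.comp_apply, LinearMap.mulLeft_apply,
      LinearMap.mulRight_apply, normalOrder_ordered]
    rcases i with i | i
    · rw [← MvPolynomial.rename_X (f := ip), mul_comm, mul_right_comm, mul_assoc _ _
        (MvPolynomial.rename ip _), ← map_mul, normalOrder_ordered, map_mul, hp_X, mul_assoc _ _
        (x K n m _), cen_commutes, mul_assoc, mul_assoc, mul_assoc]
    · rw [← MvPolynomial.rename_X (f := iz), mul_comm, mul_assoc _ (MvPolynomial.rename iz _),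
        ← map_mul, normalOrder_ordered, map_mul, cen_X, mul_assoc _ _ (x K n m _)]
  exact congrArg (fun F => F f) h

theorem iq_injective : Function.Injective (iq : Fin n → Idx n m) := Sum.inl_injective
theorem ip_injective : Function.Injective (ip : Fin n → Idx n m) :=
  Sum.inr_injective.comp Sum.inl_injective
theorem iz_injective : Function.Injective (iz : Fin m → Idx n m) :=
  Sum.inr_injective.comp Sum.inr_injective

/-- In an ordered product p_i commutes with the p-factor and the central factor, so its commutator
differentiates the q-factor only. The analogue for q_i differentiates only the p-factor. -/
theorem ad_p_normalOrder (i : Fin n) (f : MvPolynomial (Idx n m) K) :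
    ad (x K n m (ip i)) (normalOrder K n m f)
      = normalOrder K n m (MvPolynomial.pderiv (iq i) f) := by
  have h : ad (x K n m (ip i)) ∘ₗ normalOrder K n m
      = normalOrder K n m ∘ₗ (MvPolynomial.pderiv (R := K) (iq i : Idx n m)).toLinearMap := by
    refine linearMap_ext_ordered fun f g h => ?_
    have e : MvPolynomial.pderiv (iq i) (MvPolynomial.rename iq f * MvPolynomial.rename ip g
        * MvPolynomial.rename iz h) = MvPolynomial.rename iq (MvPolynomial.pderiv i f)
        * MvPolynomial.rename ip g * MvPolynomial.rename iz h := by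
      rw [Derivation.leibniz, Derivation.leibniz, pderiv_rename_eq_zero K iz _ (by simp),
        pderiv_rename_eq_zero K ip _ (by simp), MvPolynomial.pderiv_rename iq_injective]
      simp only [smul_eq_mul]
      ring
    rw [LinearMap.comp_apply, LinearMap.comp_apply, Derivation.coeFn_coe, e,
      normalOrder_ordered, normalOrder_ordered, ← p_commutator_hq, ad, LinearMap.sub_apply,
      LinearMap.mulLeft_apply, LinearMap.mulRight_apply]
    have e1 := cen_commutes (n := n) h (x K n m (ip i))
    have e2 : hp K n m g * x K n m (ip i) = x K n m (ip i) * hp K n m g := by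
      rw [← hp_X, ← map_mul, mul_comm, map_mul]
    rw [mul_assoc _ _ (x K n m _), e1, ← mul_assoc _ (x K n m _), mul_assoc _ _ (x K n m _), e2,
      sub_mul, sub_mul]
    simp only [mul_assoc]
  exact congrArg (fun F => F f) h

theorem ad_q_normalOrder (i : Fin n) (f : MvPolynomial (Idx n m) K) :
    (-ad (x K n m (iq i))) (normalOrder K n m f)
      = normalOrder K n m (MvPolynomial.pderiv (ip i) f) := by
  have h : (-ad (x K n m (iq i))) ∘ₗ normalOrder K n m
      = normalOrder K n m ∘ₗ (MvPolynomial.pderiv (R := K) (ip i : Idx n m)).toLinearMap := by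
    refine linearMap_ext_ordered fun f g h => ?_
    have e : MvPolynomial.pderiv (ip i) (MvPolynomial.rename iq f * MvPolynomial.rename ip g
        * MvPolynomial.rename iz h) = MvPolynomial.rename iq f
        * MvPolynomial.rename ip (MvPolynomial.pderiv i g) * MvPolynomial.rename iz h := by
      rw [Derivation.leibniz, Derivation.leibniz, pderiv_rename_eq_zero K iz _ (by simp),
        pderiv_rename_eq_zero K iq _ (by simp), MvPolynomial.pderiv_rename ip_injective]
      simp only [smul_eq_mul]
      ring
    rw [LinearMap.comp_apply, LinearMap.comp_apply, Derivation.coeFn_coe, e,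
      normalOrder_ordered, normalOrder_ordered, ← q_commutator_hp, ad, LinearMap.neg_apply,
      LinearMap.sub_apply, neg_sub, LinearMap.mulLeft_apply, LinearMap.mulRight_apply]
    have e1 := cen_commutes (n := n) h (x K n m (iq i))
    have e2 : x K n m (iq i) * hq K n m f = hq K n m f * x K n m (iq i) := by
      rw [← hq_X, ← map_mul, mul_comm, map_mul]
    rw [mul_assoc _ _ (x K n m _), e1, ← mul_assoc (x K n m (iq i)), ← mul_assoc (x K n m (iq i)),
      e2, mul_sub, sub_mul]
    simp only [mul_assoc]
  exact congrArg (fun F => F f) h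

theorem pd_cen (l : Fin m) (f : MvPolynomial (Fin m) K) :
    pd K n m l (cen K n m f) = cen K n m (MvPolynomial.pderiv l f) := rfl

/-- `A_n` embedded in `A`. -/
noncomputable abbrev weylIncl (K : Type*) [Field K] (n m : ℕ) : Weyl K n →ₐ[K] Alg K n m :=
  Algebra.TensorProduct.includeLeft

theorem pd_weyl_mul (l : Fin m) (w : Weyl K n) (a : Alg K n m) :
    pd K n m l (weylIncl K n m w * a) = weylIncl K n m w * pd K n m l a := by
  induction a using TensorProduct.induction_on with
  | zero => simp
  | tmul v f => simp [pd]
  | add a b ha hb => rw [mul_add, map_add, ha, hb, map_add, mul_add]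

/-- Since `pd` is linear over A_n, this lets the q-part of an ordered product pass through it. -/
theorem hq_mem_range (f : MvPolynomial (Fin n) K) : ∃ w, weylIncl K n m w = hq K n m f := by
  induction f using MvPolynomial.induction_on with
  | C a => exact ⟨algebraMap _ _ a, by
      rw [← MvPolynomial.algebraMap_eq, AlgHom.commutes, AlgHom.commutes]⟩
  | add f g hf hg =>
    obtain ⟨v, hv⟩ := hf
    obtain ⟨w, hw⟩ := hg
    exact ⟨v + w, by rw [map_add, hv, hw, map_add]⟩
  | mul_X f i hf =>
    obtain ⟨v, hv⟩ := hf
    exact ⟨v * Weyl.q K n i, by rw [map_mul, hv, map_mul, hq_X]; rfl⟩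

theorem hp_mem_range (f : MvPolynomial (Fin n) K) : ∃ w, weylIncl K n m w = hp K n m f := by
  induction f using MvPolynomial.induction_on with
  | C a => exact ⟨algebraMap _ _ a, by
      rw [← MvPolynomial.algebraMap_eq, AlgHom.commutes, AlgHom.commutes]⟩
  | add f g hf hg =>
    obtain ⟨v, hv⟩ := hf
    obtain ⟨w, hw⟩ := hg
    exact ⟨v + w, by rw [map_add, hv, hw, map_add]⟩
  | mul_X f i hf =>
    obtain ⟨v, hv⟩ := hf
    exact ⟨v * Weyl.p K n i, by rw [map_mul, hv, map_mul, hp_X]; rfl⟩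

theorem pd_normalOrder (l : Fin m) (f : MvPolynomial (Idx n m) K) :
    pd K n m l (normalOrder K n m f)
      = normalOrder K n m (MvPolynomial.pderiv (iz l) f) := by
  have h : pd K n m l ∘ₗ normalOrder K n m
      = normalOrder K n m ∘ₗ (MvPolynomial.pderiv (R := K) (iz l : Idx n m)).toLinearMap := by
    refine linearMap_ext_ordered fun f g h => ?_
    have e : MvPolynomial.pderiv (iz l) (MvPolynomial.rename iq f * MvPolynomial.rename ip g
        * MvPolynomial.rename iz h) = MvPolynomial.rename iq f
        * MvPolynomial.rename ip g * MvPolynomial.rename iz (MvPolynomial.pderiv l h) := by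
      rw [Derivation.leibniz, Derivation.leibniz, pderiv_rename_eq_zero K iq _ (by simp),
        pderiv_rename_eq_zero K ip _ (by simp), MvPolynomial.pderiv_rename iz_injective]
      simp only [smul_eq_mul]
      ring
    obtain ⟨v, hv⟩ := hq_mem_range (m := m) f
    obtain ⟨w, hw⟩ := hp_mem_range (m := m) g
    rw [LinearMap.comp_apply, LinearMap.comp_apply, Derivation.coeFn_coe, e,
      normalOrder_ordered, normalOrder_ordered, ← hv, ← hw, mul_assoc, pd_weyl_mul, pd_weyl_mul,
      pd_cen, mul_assoc]
  exact congrArg (fun F => F f) h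

end Symbol

/-! ### Weight filtration of polynomial rings. -/

section WeightFiltration

variable {K : Type*} [Field K] {ι : Type*}

variable (K) in
/-- The polynomials all of whose monomials have weight less than `d`. -/
def filt (w : ι → ℕ) (d : ℕ) : Submodule K (MvPolynomial ι K) where
  carrier := {f | ∀ β : ι →₀ ℕ, d ≤ Finsupp.weight w β → f.coeff β = 0}
  zero_mem' := fun _ _ => MvPolynomial.coeff_zero _
  add_mem' := fun hf hg β h => by rw [MvPolynomial.coeff_add, hf β h, hg β h, add_zero]
  smul_mem' := fun c f hf β h => by rw [MvPolynomial.coeff_smul, hf β h, smul_zero]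

theorem filt_mono (w : ι → ℕ) {d e : ℕ} (h : d ≤ e) : filt K w d ≤ filt K w e :=
  fun _ hf β hβ => hf β (h.trans hβ)

theorem eq_zero_of_mem_filt_zero {w : ι → ℕ} {f : MvPolynomial ι K} (hf : f ∈ filt K w 0) :
    f = 0 :=
  MvPolynomial.ext _ _ fun β => hf β (Nat.zero_le _)

theorem monomial_mem_filt {w : ι → ℕ} {α : ι →₀ ℕ} {d : ℕ} (h : Finsupp.weight w α < d) (c : K) :
    MvPolynomial.monomial α c ∈ filt K w d := by
  classical
  intro β hβ
  rw [MvPolynomial.coeff_monomial, if_neg]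
  rintro rfl
  omega

/-- The filtration index is a strict bound, so index 0 is the zero space and index d + 1 means
weight at most d. If two exponents have total weight at least d + e, the first weighs more than d or
the second at least e. -/
theorem mul_mem_filt {w : ι → ℕ} {d e : ℕ} {f g : MvPolynomial ι K} (hf : f ∈ filt K w (d + 1))
    (hg : g ∈ filt K w e) : f * g ∈ filt K w (d + e) := by
  classical
  intro β hβ
  rw [MvPolynomial.coeff_mul]
  refine Finset.sum_eq_zero fun p hp => ?_
  rw [← Finset.HasAntidiagonal.mem_antidiagonal.1 hp, map_add] at hβ
  rcases le_or_gt (d + 1) (Finsupp.weight w p.1) with h | h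
  · rw [hf _ h, zero_mul]
  · rw [hg _ (by omega), mul_zero]

/-- The top weighted components are nonzero, and so is their product because the polynomial ring is
a domain. All other contributions have lower weight. -/
theorem mul_notMem_filt {w : ι → ℕ} {d e : ℕ} {f g : MvPolynomial ι K}
    (hf : f ∈ filt K w (d + 1)) (hf' : f ∉ filt K w d)
    (hg : g ∈ filt K w (e + 1)) (hg' : g ∉ filt K w e) : f * g ∉ filt K w (d + e) := by
  classical
  have key : ∀ {k : ℕ} {h : MvPolynomial ι K}, h ∈ filt K w (k + 1) →
      h - MvPolynomial.weightedHomogeneousComponent w k h ∈ filt K w k := by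
    intro k h hh β hβ
    rw [MvPolynomial.coeff_sub, MvPolynomial.coeff_weightedHomogeneousComponent]
    split_ifs with hk
    · rw [sub_self]
    · rw [hh β (by omega), sub_zero]
  have hne : ∀ {k : ℕ} {h : MvPolynomial ι K}, h ∈ filt K w (k + 1) → h ∉ filt K w k →
      MvPolynomial.weightedHomogeneousComponent w k h ≠ 0 := by
    intro k h hh hh' h0
    have := key hh
    rw [h0, sub_zero] at this
    exact hh' this
  set fd := MvPolynomial.weightedHomogeneousComponent w d f with hfd
  set ge := MvPolynomial.weightedHomogeneousComponent w e g with hge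
  intro hfg
  have h1 : (f - fd) * g ∈ filt K w (d + e) := by
    rw [mul_comm, add_comm]; exact mul_mem_filt hg (key hf)
  have hfd' : fd ∈ filt K w (d + 1) := by
    have := Submodule.sub_mem _ hf (filt_mono w (Nat.le_succ d) (key hf))
    rwa [sub_sub_cancel] at this
  have h2 : fd * (g - ge) ∈ filt K w (d + e) := mul_mem_filt hfd' (key hg)
  have h3 : fd * ge ∈ filt K w (d + e) := by
    have : fd * ge = f * g - (f - fd) * g - fd * (g - ge) := by ring
    rw [this]
    exact Submodule.sub_mem _ (Submodule.sub_mem _ hfg h1) h2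
  have h4 : MvPolynomial.IsWeightedHomogeneous w (fd * ge) (d + e) :=
    (MvPolynomial.weightedHomogeneousComponent_isWeightedHomogeneous d f).mul
      (MvPolynomial.weightedHomogeneousComponent_isWeightedHomogeneous e g)
  refine mul_ne_zero (hne hf hf') (hne hg hg') (MvPolynomial.ext _ _ fun β => ?_)
  rw [MvPolynomial.coeff_zero]
  by_contra hβ
  exact hβ (h3 β (h4 hβ).ge)

theorem exists_mem_filt (w : ι → ℕ) (f : MvPolynomial ι K) : ∃ d, f ∈ filt K w d := by
  refine ⟨f.support.sup (Finsupp.weight w) + 1, fun β hβ => ?_⟩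
  by_contra h
  have := Finset.le_sup (f := Finsupp.weight w) (MvPolynomial.mem_support_iff.2 h)
  omega

theorem pderiv_mem_filt {w : ι → ℕ} {i : ι} (hi : 0 < w i) {e : ℕ} {f : MvPolynomial ι K}
    (hf : f ∈ filt K w (e + 1)) : MvPolynomial.pderiv i f ∈ filt K w e := by
  intro β hβ
  rw [MvPolynomial.coeff_pderiv, hf, zero_mul]
  rw [map_add, Finsupp.weight_single, one_smul]
  omega

end WeightFiltration

/-! ### The weight filtration of A and additivity of degree. -/

section AlgFiltration

variable {K : Type*} [Field K] {n m : ℕ}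

variable (K n m) in
/-- The elements of `A` all of whose monomials have weight less than `d`. -/
noncomputable def afilt (w : Idx n m → ℕ) (d : ℕ) : Submodule K (Alg K n m) :=
  (filt K w d).comap (symb K n m).toLinearMap

theorem mem_afilt {w : Idx n m → ℕ} {d : ℕ} {a : Alg K n m} :
    a ∈ afilt K n m w d ↔ symb K n m a ∈ filt K w d := Iff.rfl

theorem afilt_mono (w : Idx n m → ℕ) {d e : ℕ} (h : d ≤ e) :
    afilt K n m w d ≤ afilt K n m w e := fun _ ha => filt_mono w h ha

theorem eq_zero_of_mem_afilt_zero {w : Idx n m → ℕ} {a : Alg K n m} (ha : a ∈ afilt K n m w 0) :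
    a = 0 := by
  rw [← (symb K n m).map_eq_zero_iff]
  exact eq_zero_of_mem_filt_zero ha

/-- `a` has weight at most `d` and acts on polynomials as multiplication by its symbol, up to
terms of lower weight. -/
def ActsBySymbol (w : Idx n m → ℕ) (a : Alg K n m) (d : ℕ) : Prop :=
  symb K n m a ∈ filt K w (d + 1) ∧ ∀ (e : ℕ), ∀ g ∈ filt K w (e + 1),
    rep K n m a g - symb K n m a * g ∈ filt K w (d + e)

theorem ActsBySymbol.rep_mem {w : Idx n m → ℕ} {a : Alg K n m} {d : ℕ} (h : ActsBySymbol w a d)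
    {e : ℕ} {g : MvPolynomial (Idx n m) K} (hg : g ∈ filt K w e) :
    rep K n m a g ∈ filt K w (d + e) := by
  rcases e with _ | e
  · rw [eq_zero_of_mem_filt_zero hg, map_zero]; exact Submodule.zero_mem _
  · have := Submodule.add_mem _ (filt_mono w (Nat.le_succ (d + e)) (h.2 e g hg))
      (mul_mem_filt h.1 hg)
    rwa [sub_add_cancel] at this

theorem ActsBySymbol.mul {w : Idx n m → ℕ} {a b : Alg K n m} {d e : ℕ} (ha : ActsBySymbol w a d)
    (hb : ActsBySymbol w b e) : ActsBySymbol w (a * b) (d + e) := by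
  refine ⟨?_, fun k g hg => ?_⟩
  · rw [symb_mul]
    exact ha.rep_mem hb.1
  · rw [map_mul, Module.End.mul_apply, symb_mul]
    -- With S the symbol, (ab)g - S(ab)g is the sum of a(bg - S(b)g) and a(S(b)g) - S(a)S(b)g, minus
    -- g(aS(b) - S(a)S(b)). Each of the three has lower weight.
    have h1 := ha.rep_mem (hb.2 k g hg)
    have h2 := ha.2 (e + k) _ (mul_mem_filt (d := e) (e := k + 1) hb.1 hg)
    have h3 := mul_mem_filt (w := w) (d := k) (e := d + e) hg (ha.2 e _ hb.1)
    rw [← add_assoc] at h1 h2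
    rw [add_comm k] at h3
    have := Submodule.sub_mem _ (Submodule.add_mem _ h1 h2) h3
    rw [map_sub] at this
    convert this using 1
    ring

theorem actsBySymbol_zero_weight_one (w : Idx n m → ℕ) :
    ActsBySymbol w (1 : Alg K n m) 0 := by
  refine ⟨?_, fun e g hg => ?_⟩
  · rw [symb_one]
    exact monomial_mem_filt (α := 0) (by simp) 1
  · rw [symb_one, map_one (rep K n m), Module.End.one_apply, one_mul, sub_self]
    exact Submodule.zero_mem _

theorem ActsBySymbol.pow {w : Idx n m → ℕ} {a : Alg K n m} {d : ℕ} (ha : ActsBySymbol w a d)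
    (k : ℕ) : ActsBySymbol w (a ^ k) (k * d) := by
  induction k with
  | zero => rw [pow_zero, zero_mul]; exact actsBySymbol_zero_weight_one w
  | succ k ih => rw [pow_succ, Nat.succ_mul]; exact ih.mul ha

theorem ActsBySymbol.ofFn_prod {w : Idx n m → ℕ} {r : ℕ} {a : Fin r → Alg K n m} {d : Fin r → ℕ}
    (ha : ∀ i, ActsBySymbol w (a i) (d i)) :
    ActsBySymbol w (List.ofFn a).prod (∑ i, d i) := by
  induction r with
  | zero => simpa using actsBySymbol_zero_weight_one w
  | succ r ih =>
    rw [List.ofFn_succ, List.prod_cons, Fin.sum_univ_succ]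
    exact (ha 0).mul (ih fun i => ha i.succ)

/-- The only correction is the derivative by q_i in the action of p_i, and it lowers weight as soon
as q_i has positive weight. The other weights are unrestricted, so central variables may be given
weight zero later. -/
theorem actsBySymbol_x {w : Idx n m → ℕ} (hw : ∀ i, 0 < w (iq i)) (i : Idx n m) :
    ActsBySymbol w (x K n m i) (w i) := by
  refine ⟨?_, fun e g hg => ?_⟩
  · rw [symb_x]
    exact monomial_mem_filt (by rw [Finsupp.weight_single, one_smul]; omega) 1
  · rw [symb_x]
    rcases i with i | i | i
    · rw [rep_q, sub_self]; exact Submodule.zero_mem _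
    · rw [rep_p, add_sub_cancel_left]
      exact filt_mono w (by omega) (pderiv_mem_filt (hw i) hg)
    · rw [← cen_X, rep_cen, MvPolynomial.rename_X, sub_self]; exact Submodule.zero_mem _

theorem actsBySymbol_mono {w : Idx n m → ℕ} (hw : ∀ i, 0 < w (iq i)) (α : Idx n m →₀ ℕ) :
    ActsBySymbol w (mono K n m α) (Finsupp.weight w α) := by
  have : Finsupp.weight w α = (∑ i, α (iq i) * w (iq i)) + (∑ i, α (ip i) * w (ip i))
      + ∑ i, α (iz i) * w (iz i) := by
    rw [Finsupp.weight_apply, Finsupp.sum_fintype _ _ (by simp), Fintype.sum_sum_type,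
      Fintype.sum_sum_type, add_assoc]
    rfl
  rw [this, mono]
  exact ((ActsBySymbol.ofFn_prod fun i => (actsBySymbol_x hw _).pow _).mul
    (ActsBySymbol.ofFn_prod fun i => (actsBySymbol_x hw _).pow _)).mul
    (ActsBySymbol.ofFn_prod fun i => (actsBySymbol_x hw _).pow _)

theorem eq_sum_mono (a : Alg K n m) :
    a = ∑ α ∈ (symb K n m a).support, (symb K n m a).coeff α • mono K n m α := by
  apply (symb K n m).injective
  rw [map_sum]
  conv_lhs => rw [(symb K n m a).as_sum]
  refine Finset.sum_congr rfl fun α _ => ?_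
  rw [map_smul, symb_mono, MvPolynomial.smul_monomial, smul_eq_mul, mul_one]

theorem actsBySymbol_of_mem {w : Idx n m → ℕ} (hw : ∀ i, 0 < w (iq i)) {a : Alg K n m} {d : ℕ}
    (ha : a ∈ afilt K n m w (d + 1)) : ActsBySymbol w a d := by
  refine ⟨ha, fun e g hg => ?_⟩
  have hL : rep K n m a g - symb K n m a * g = ∑ α ∈ (symb K n m a).support,
      (symb K n m a).coeff α • (rep K n m (mono K n m α) g - symb K n m (mono K n m α) * g) := by
    conv_lhs => rw [eq_sum_mono a]
    rw [map_sum, map_sum, LinearMap.sum_apply, Finset.sum_mul, ← Finset.sum_sub_distrib]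
    refine Finset.sum_congr rfl fun α _ => ?_
    rw [map_smul, map_smul, LinearMap.smul_apply, smul_mul_assoc, smul_sub]
  rw [hL]
  refine Submodule.sum_mem _ fun α hα => Submodule.smul_mem _ _ ?_
  refine filt_mono w (Nat.add_le_add_right ?_ e) ((actsBySymbol_mono hw α).2 e g hg)
  by_contra h
  exact MvPolynomial.mem_support_iff.1 hα (ha α (by omega))

theorem mul_mem_afilt {w : Idx n m → ℕ} (hw : ∀ i, 0 < w (iq i)) {a b : Alg K n m} {d e : ℕ}
    (ha : a ∈ afilt K n m w (d + 1)) (hb : b ∈ afilt K n m w e) :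
    a * b ∈ afilt K n m w (d + e) := by
  rw [mem_afilt, symb_mul]
  exact (actsBySymbol_of_mem hw ha).rep_mem hb

/-- The symbol of `a * b` differs from the product of the symbols by terms of weight below d + e, so
the polynomial case applies. -/
theorem mul_notMem_afilt {w : Idx n m → ℕ} (hw : ∀ i, 0 < w (iq i)) {a b : Alg K n m} {d e : ℕ}
    (ha : a ∈ afilt K n m w (d + 1)) (ha' : a ∉ afilt K n m w d)
    (hb : b ∈ afilt K n m w (e + 1)) (hb' : b ∉ afilt K n m w e) :
    a * b ∉ afilt K n m w (d + e) := by
  intro h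
  rw [mem_afilt, symb_mul] at h
  have h2 := (actsBySymbol_of_mem hw ha).2 e (symb K n m b) hb
  have := Submodule.sub_mem _ h h2
  rw [sub_sub_cancel] at this
  exact mul_notMem_filt ha ha' hb hb' this

theorem exists_mem_afilt_of_ne_zero (w : Idx n m → ℕ) {a : Alg K n m} (ha : a ≠ 0) :
    ∃ d, a ∈ afilt K n m w (d + 1) ∧ a ∉ afilt K n m w d := by
  classical
  have h := exists_mem_filt w (symb K n m a)
  have h0 : Nat.find h ≠ 0 := fun h0 => ha (eq_zero_of_mem_afilt_zero (w := w) (by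
    have := Nat.find_spec h
    rwa [h0] at this))
  obtain ⟨d, hd⟩ := Nat.exists_eq_succ_of_ne_zero h0
  have h1 := Nat.find_spec h
  rw [hd] at h1
  exact ⟨d, h1, Nat.find_min h (by omega)⟩

theorem one_mem_afilt (w : Idx n m → ℕ) : (1 : Alg K n m) ∈ afilt K n m w 1 :=
  (actsBySymbol_zero_weight_one w).1

theorem one_notMem_afilt (w : Idx n m → ℕ) : (1 : Alg K n m) ∉ afilt K n m w 0 := by
  intro h
  rw [mem_afilt, symb_one] at h
  exact one_ne_zero (eq_zero_of_mem_filt_zero h)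

theorem pow_mem_afilt {w : Idx n m → ℕ} (hw : ∀ i, 0 < w (iq i)) {a : Alg K n m} {d : ℕ}
    (ha : a ∈ afilt K n m w (d + 1)) (k : ℕ) : a ^ k ∈ afilt K n m w (k * d + 1) :=
  ((actsBySymbol_of_mem hw ha).pow k).1

theorem pow_notMem_afilt {w : Idx n m → ℕ} (hw : ∀ i, 0 < w (iq i)) {a : Alg K n m} {d : ℕ}
    (ha : a ∈ afilt K n m w (d + 1)) (ha' : a ∉ afilt K n m w d) (k : ℕ) :
    a ^ k ∉ afilt K n m w (k * d) := by
  induction k with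
  | zero => rw [pow_zero, zero_mul]; exact one_notMem_afilt w
  | succ k ih =>
    rw [pow_succ, Nat.succ_mul]
    exact mul_notMem_afilt hw (pow_mem_afilt hw ha k) ih ha ha'

end AlgFiltration

/-! ### Dimension of the space of elements of bounded degree. -/

section Counting

variable {K : Type*} [Field K] {ι : Type*} [DecidableEq ι]

/-- The exponent vectors supported in `S` with sum at most `M`. -/
def exps (S : Finset ι) (M : ℕ) : Finset (ι →₀ ℕ) :=
  (Finset.range (M + 1)).biUnion fun k => S.finsuppAntidiag k

theorem mem_exps {S : Finset ι} {M : ℕ} {β : ι →₀ ℕ} :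
    β ∈ exps S M ↔ S.sum β ≤ M ∧ β.support ⊆ S := by
  simp only [exps, Finset.mem_biUnion, Finset.mem_range, Finset.mem_finsuppAntidiag]
  constructor
  · rintro ⟨k, hk, h1, h2⟩; exact ⟨by omega, h2⟩
  · rintro ⟨h1, h2⟩; exact ⟨_, by omega, rfl, h2⟩

theorem card_exps (S : Finset ι) (M : ℕ) : (exps S M).card = (S.card + M).choose M := by
  rw [exps, Finset.card_biUnion]
  · induction M with
    | zero => simp
    | succ M ih =>
      rw [Finset.sum_range_succ, ih, Finset.card_finsuppAntidiag_nat_eq_choose, ← add_assoc,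
        Nat.choose_succ_succ, Nat.add_sub_cancel]
  · intro i _ j _ hij
    rw [Function.onFun, Finset.disjoint_left]
    intro β h1 h2
    rw [Finset.mem_finsuppAntidiag] at h1 h2
    exact hij (h1.1.symm.trans h2.1)

omit [DecidableEq ι] in
theorem weight_one_eq [Fintype ι] (β : ι →₀ ℕ) :
    Finsupp.weight (fun _ => 1) β = Finset.univ.sum β := by
  rw [Finsupp.weight_apply, Finsupp.sum_fintype _ _ (by simp)]
  simp

variable (K) in
/-- A weight piece of the polynomial ring with finitely many monomials is a coordinate space. -/
noncomputable def filtEquiv (w : ι → ℕ) (d : ℕ) (T : Finset (ι →₀ ℕ))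
    (hT : ∀ β, β ∈ T ↔ Finsupp.weight w β < d) : filt K w d ≃ₗ[K] (T → K) where
  toFun f β := MvPolynomial.coeff (β : ι →₀ ℕ) (f : MvPolynomial ι K)
  map_add' f g := by funext β; simp
  map_smul' c f := by funext β; simp
  invFun c := ⟨∑ β : T, MvPolynomial.monomial (β : ι →₀ ℕ) (c β),
    Submodule.sum_mem _ fun β _ => monomial_mem_filt ((hT _).1 β.2) _⟩
  left_inv f := by
    ext γ
    simp only [MvPolynomial.coeff_sum, MvPolynomial.coeff_monomial]
    by_cases hγ : γ ∈ T
    · rw [Finset.sum_eq_single ⟨γ, hγ⟩]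
      · simp
      · intro β _ hβ
        rw [if_neg]
        rintro rfl
        exact hβ rfl
      · simp
    · rw [f.2 γ (by rw [hT] at hγ; omega)]
      refine Finset.sum_eq_zero fun β _ => ?_
      rw [if_neg]
      rintro rfl
      exact hγ β.2
  right_inv c := by
    funext γ
    simp only [MvPolynomial.coeff_sum, MvPolynomial.coeff_monomial]
    rw [Finset.sum_eq_single γ]
    · simp
    · intro β _ hβ
      rw [if_neg]
      intro h
      exact hβ (Subtype.ext h)
    · simp

variable {n m : ℕ}

theorem card_idx : Fintype.card (Idx n m) = 2 * n + m := by
  simp only [Idx, Fintype.card_sum, Fintype.card_fin]; ring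

variable (K n m) in
/-- Coordinates on the elements of `A` of degree at most `M`. -/
noncomputable def afiltEquiv (M : ℕ) : afilt K n m (fun _ => 1) (M + 1) ≃ₗ[K]
    (exps (Finset.univ : Finset (Idx n m)) M → K) :=
  ((symb K n m).submoduleMap (afilt K n m (fun _ => 1) (M + 1))).trans
    ((LinearEquiv.ofEq _ _ (by
        rw [afilt]
        exact Submodule.map_comap_eq_of_surjective (symb K n m).surjective _)).trans
      (filtEquiv K (fun _ => 1) (M + 1) (exps Finset.univ M) fun β => by
        rw [mem_exps, weight_one_eq, Nat.lt_succ_iff]; simp))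

instance (M : ℕ) : FiniteDimensional K (afilt K n m (fun _ => 1) (M + 1)) :=
  (afiltEquiv K n m M).symm.finiteDimensional

theorem finrank_afilt (M : ℕ) : Module.finrank K (afilt K n m (fun _ => 1) (M + 1))
    = (2 * n + m + M).choose M := by
  rw [(afiltEquiv K n m M).finrank_eq, Module.finrank_fintype_fun_eq_card, Fintype.card_coe,
    card_exps, Finset.card_univ, card_idx]

end Counting

/-! ### Derivations, slices and independence of powers. -/

section Powers

variable {K A : Type*} [Field K] [Ring A] [Algebra K A]

/-- The Leibniz rule for a linear endomorphism of a possibly noncommutative algebra. -/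
def IsDer (δ : A →ₗ[K] A) : Prop := ∀ a b, δ (a * b) = δ a * b + a * δ b

theorem IsDer.map_one {δ : A →ₗ[K] A} (hδ : IsDer δ) : δ 1 = 0 := by
  have := hδ 1 1
  rw [mul_one, mul_one, one_mul] at this
  exact left_eq_add.1 this

theorem IsDer.map_slice_pow {δ : A →ₗ[K] A} (hδ : IsDer δ) {y : A} (hy : δ y = 1) (k : ℕ) :
    δ (y ^ (k + 1)) = ((k + 1 : ℕ) : K) • y ^ k := by
  induction k with
  | zero => rw [zero_add, pow_one, hy, pow_zero, Nat.cast_one, one_smul]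
  | succ k ih =>
    rw [pow_succ, hδ, ih, hy, smul_mul_assoc, ← pow_succ, mul_one, Nat.cast_succ (k + 1), add_smul,
      one_smul]

theorem IsDer.map_pow_of_eq_zero {δ : A →ₗ[K] A} (hδ : IsDer δ) {y : A} (hy : δ y = 0) (k : ℕ) :
    δ (y ^ k) = 0 := by
  induction k with
  | zero => rw [pow_zero, hδ.map_one]
  | succ k ih => rw [pow_succ, hδ, ih, hy, zero_mul, mul_zero, add_zero]

theorem IsDer.neg {δ : A →ₗ[K] A} (hδ : IsDer δ) : IsDer (-δ) := by
  intro b c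
  rw [LinearMap.neg_apply, LinearMap.neg_apply, LinearMap.neg_apply, hδ, neg_mul, mul_neg, neg_add]

/-- The powers of a slice are independent over the constants. -/
theorem IsDer.slice_independent [CharZero K] {δ : A →ₗ[K] A} (hδ : IsDer δ) {y : A} (hy : δ y = 1)
    (N : ℕ) (u : ℕ → A) (hu : ∀ k, δ (u k) = 0)
    (h : ∑ k ∈ Finset.range N, u k * y ^ k = 0) : ∀ k < N, u k = 0 := by
  induction N generalizing u with
  | zero => intro k hk; omega
  | succ N ih =>
    -- Applying δ differentiates the relation in y. The new coefficients are still constants, and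
    -- characteristic zero allows division by k + 1.
    have h1 : ∑ k ∈ Finset.range N, (((k + 1 : ℕ) : K) • u (k + 1)) * y ^ k = 0 := by
      have := congrArg δ h
      rw [map_zero, map_sum, Finset.sum_range_succ', pow_zero, mul_one, hu, add_zero] at this
      rw [← this]
      refine Finset.sum_congr rfl fun k _ => ?_
      rw [hδ, hu, zero_mul, zero_add, hδ.map_slice_pow hy, smul_mul_assoc, mul_smul_comm]
    have h2 : ∀ k < N, u (k + 1) = 0 := fun k hk => by
      have := ih _ (fun k => by rw [map_smul, hu, smul_zero]) h1 k hk
      exact (smul_eq_zero.1 this).resolve_left (Nat.cast_ne_zero.2 (Nat.succ_ne_zero k))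
    rw [Finset.sum_range_succ', Finset.sum_eq_zero fun k hk => by
      rw [h2 k (Finset.mem_range.1 hk), zero_mul], pow_zero, mul_one, zero_add] at h
    rintro (_ | k) hk
    · exact h
    · exact h2 k (by omega)

/-- If the powers of `y` are independent over `U`, then `U + U y + ⋯ + U y ^ N` has dimension
`(N + 1) dim U`. -/
theorem exists_submodule_powers (U : Submodule K A) [FiniteDimensional K U] (y : A) (N : ℕ)
    (hind : ∀ u : ℕ → A, (∀ k, u k ∈ U) → ∑ k ∈ Finset.range (N + 1), u k * y ^ k = 0 →
      ∀ k < N + 1, u k = 0) :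
    ∃ V : Submodule K A, FiniteDimensional K V ∧
      Module.finrank K V = (N + 1) * Module.finrank K U ∧
      ∀ W : Submodule K A, (∀ k ≤ N, ∀ u ∈ U, u * y ^ k ∈ W) → V ≤ W := by
  let T : (Fin (N + 1) → U) →ₗ[K] A := ∑ k : Fin (N + 1),
    (LinearMap.mulRight K (y ^ (k : ℕ))) ∘ₗ U.subtype ∘ₗ LinearMap.proj k
  have hT : ∀ u, T u = ∑ k : Fin (N + 1), (u k : A) * y ^ (k : ℕ) := fun u => by
    simp [T, LinearMap.sum_apply]
  have hinj : Function.Injective T := by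
    rw [← LinearMap.ker_eq_bot, LinearMap.ker_eq_bot']
    intro u hu
    rw [hT] at hu
    let v : ℕ → A := fun k => if h : k < N + 1 then u ⟨k, h⟩ else 0
    have h := hind v (fun k => by
      simp only [v]; split_ifs
      · exact (u _).2
      · exact zero_mem _) (by
      rw [Finset.sum_range, ← hu]
      refine Finset.sum_congr rfl fun k _ => ?_
      simp only [v, k.2, dif_pos])
    funext k
    have := h k k.2
    simp only [v, k.2, dif_pos] at this
    exact Subtype.ext this
  refine ⟨LinearMap.range T, inferInstance, ?_, ?_⟩
  · rw [LinearMap.finrank_range_of_inj hinj, Module.finrank_pi_fintype]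
    simp
  · rintro W hW _ ⟨u, rfl⟩
    rw [hT]
    exact Submodule.sum_mem _ fun k _ => hW k (by omega) _ (u k).2

end Powers

/-! ### The centralizer of σ(A_n), by comparison of growth. -/

section Growth

variable {K : Type*} [Field K] {n m : ℕ}

theorem mul_pow_mem_afilt {N D r k : ℕ} (hk : k ≤ N) {u y : Alg K n m}
    (hu : u ∈ afilt K n m (fun _ => 1) (r * (N * D) + 1))
    (hy : y ∈ afilt K n m (fun _ => 1) (D + 1)) :
    u * y ^ k ∈ afilt K n m (fun _ => 1) ((r + 1) * (N * D) + 1) := by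
  have := mul_mem_afilt (fun _ => Nat.one_pos) hu (pow_mem_afilt (fun _ => Nat.one_pos) hy k)
  refine afilt_mono _ ?_ this
  have := Nat.mul_le_mul_right D hk
  rw [Nat.succ_mul]
  omega

/-- Adjoining dual slices of derivations to a space of constants multiplies dimensions. -/
theorem exists_submodule_slices [CharZero K] {ι : Type*} [DecidableEq ι]
    (δ : ι → Alg K n m →ₗ[K] Alg K n m) (hδ : ∀ i, IsDer (δ i)) (y : ι → Alg K n m)
    (hδy : ∀ i j, δ i (y j) = if i = j then 1 else 0) (N D r : ℕ)
    (hD : ∀ i, y i ∈ afilt K n m (fun _ => 1) (D + 1))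
    (B : Subalgebra K (Alg K n m)) (hB : ∀ i, y i ∈ B) (U : Submodule K (Alg K n m))
    [FiniteDimensional K U] (hUB : U ≤ Subalgebra.toSubmodule B)
    (hUD : U ≤ afilt K n m (fun _ => 1) (r * (N * D) + 1))
    (hUδ : ∀ i, ∀ u ∈ U, δ i u = 0) (J : Finset ι) :
    ∃ V : Submodule K (Alg K n m), FiniteDimensional K V ∧
      Module.finrank K V = (N + 1) ^ J.card * Module.finrank K U ∧
      V ≤ Subalgebra.toSubmodule B ∧
      V ≤ afilt K n m (fun _ => 1) ((r + J.card) * (N * D) + 1) ∧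
      ∀ i ∉ J, ∀ v ∈ V, δ i v = 0 := by
  induction J using Finset.induction_on with
  | empty =>
    exact ⟨U, inferInstance, by simp, hUB, by simpa using hUD, fun i _ => hUδ i⟩
  | insert j J hj ih =>
    obtain ⟨V, hV, hdim, hVB, hVD, hVδ⟩ := ih
    obtain ⟨V', hV', hdim', hle⟩ := exists_submodule_powers V (y j) N fun u hu h =>
      (hδ j).slice_independent (by rw [hδy, if_pos rfl]) (N + 1) u
        (fun k => hVδ j hj _ (hu k)) h
    refine ⟨V', hV', ?_, hle _ ?_, hle _ ?_, ?_⟩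
    · rw [hdim', hdim, Finset.card_insert_of_notMem hj, pow_succ]; ring
    · exact fun k _ u hu => B.mul_mem (hVB hu) (B.pow_mem (hB j) k)
    · intro k hk u hu
      rw [Finset.card_insert_of_notMem hj]
      exact mul_pow_mem_afilt hk (hVD hu) (hD j)
    · intro i hi
      rw [Finset.mem_insert, not_or] at hi
      -- The remaining derivations kill both V and y_j, hence every product u y_j^k. They stay
      -- available for the next slice.
      refine hle (LinearMap.ker (δ i)) fun k _ u hu => ?_
      rw [LinearMap.mem_ker, hδ i, hVδ i hi.2 u hu, zero_mul, zero_add,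
        (hδ i).map_pow_of_eq_zero (by rw [hδy, if_neg hi.1]), mul_zero]

theorem isDer_ad (a : Alg K n m) : IsDer (ad a) := by
  intro b c
  simp only [ad, LinearMap.sub_apply, LinearMap.mulLeft_apply, LinearMap.mulRight_apply]
  rw [sub_mul, mul_sub]
  simp only [mul_assoc]
  exact (sub_add_sub_cancel _ _ _).symm

theorem isDer_pd (l : Fin m) : IsDer (pd K n m l) := by
  intro a b
  induction a using TensorProduct.induction_on with
  | zero => simp
  | add a a' ha ha' =>
    rw [add_mul, map_add, map_add, add_mul, ha, ha', add_mul]; exact add_add_add_comm _ _ _ _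
  | tmul v f =>
    induction b using TensorProduct.induction_on with
    | zero => simp
    | add b b' hb hb' =>
      rw [mul_add, map_add, map_add, mul_add, hb, hb', mul_add]; exact add_add_add_comm _ _ _ _
    | tmul w g =>
      simp only [pd, Algebra.TensorProduct.tmul_mul_tmul, LinearMap.lTensor_tmul,
        Derivation.coeFn_coe, Derivation.leibniz, smul_eq_mul, ← TensorProduct.tmul_add]
      congr 1
      ring

/-- The inner derivations dual to the `σ(q_i)` and `σ(p_i)`. -/
noncomputable def innerPartial (σ : Alg K n m →ₐ[K] Alg K n m) :
    Fin n ⊕ Fin n → Alg K n m →ₗ[K] Alg K n m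
  | Sum.inl i => ad (σ (x K n m (ip i)))
  | Sum.inr i => -ad (σ (x K n m (iq i)))

/-- The index of a noncentral generator. -/
def inner : Fin n ⊕ Fin n → Idx n m
  | Sum.inl i => iq i
  | Sum.inr i => ip i

theorem isDer_innerPartial (σ : Alg K n m →ₐ[K] Alg K n m) (i) : IsDer (innerPartial σ i) := by
  rcases i with i | i
  · exact isDer_ad _
  · exact (isDer_ad _).neg

theorem ad_map (σ : Alg K n m →ₐ[K] Alg K n m) (a b : Alg K n m) :
    ad (σ a) (σ b) = σ (ad a b) := by
  simp only [ad, LinearMap.sub_apply, LinearMap.mulLeft_apply, LinearMap.mulRight_apply, map_sub,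
    map_mul]

theorem ad_eq_zero_of_commute {a b : Alg K n m} (h : a * b = b * a) : ad a b = 0 := by
  simp only [ad, LinearMap.sub_apply, LinearMap.mulLeft_apply, LinearMap.mulRight_apply, h]
  exact sub_self _

theorem innerPartial_x (σ : Alg K n m →ₐ[K] Alg K n m) (i j : Fin n ⊕ Fin n) :
    innerPartial σ i (σ (x K n m (inner j))) = if i = j then 1 else 0 := by
  rcases i with i | i <;> rcases j with j | j
  · rw [innerPartial, inner, ad_map, ad, LinearMap.sub_apply, LinearMap.mulLeft_apply,
      LinearMap.mulRight_apply, x_pq]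
    by_cases h : i = j <;> simp [h]
  · rw [innerPartial, inner, ad_map, ad_eq_zero_of_commute (x_pp i j)]
    simp
  · rw [innerPartial, inner, LinearMap.neg_apply, ad_map, ad_eq_zero_of_commute (x_qq i j)]
    simp
  · rw [innerPartial, inner, LinearMap.neg_apply, ad_map, ad, LinearMap.sub_apply,
      LinearMap.mulLeft_apply, LinearMap.mulRight_apply, ← map_neg, neg_sub, x_pq]
    by_cases h : i = j
    · simp [h]
    · simp [h, Ne.symm h]

/-- The weight for which the central variables have weight zero. -/
def wz : Idx n m → ℕ
  | Sum.inl _ => 1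
  | Sum.inr (Sum.inl _) => 1
  | Sum.inr (Sum.inr _) => 0

theorem weight_wz_mapDomain (β : Fin m →₀ ℕ) :
    Finsupp.weight (wz (n := n)) (β.mapDomain iz) = 0 := by
  rw [Finsupp.weight_apply]
  refine (Finsupp.sum_mapDomain_index (h := fun i c => c • wz i) (fun _ => zero_smul ℕ _)
    (fun _ _ _ => add_smul _ _ _)).trans ?_
  simp [wz]

theorem cen_mem_afilt_wz (f : MvPolynomial (Fin m) K) : cen K n m f ∈ afilt K n m wz 1 := by
  rw [mem_afilt, symb_cen]
  intro β hβ
  by_contra h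
  obtain ⟨u, rfl, -⟩ := MvPolynomial.coeff_rename_ne_zero _ _ _ h
  rw [weight_wz_mapDomain] at hβ
  omega

theorem exists_cen_eq {a : Alg K n m} (ha : a ∈ afilt K n m wz 1) : ∃ f, cen K n m f = a := by
  refine ⟨∑ β ∈ (symb K n m a).support,
    MvPolynomial.monomial (expZ β) ((symb K n m a).coeff β), ?_⟩
  apply (symb K n m).injective
  rw [symb_cen, map_sum]
  conv_rhs => rw [(symb K n m a).as_sum]
  refine Finset.sum_congr rfl fun β hβ => ?_
  rw [MvPolynomial.rename_monomial]
  suffices e : (expZ β).mapDomain iz = β by rw [e]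
  have h0 : Finsupp.weight wz β = 0 := by
    by_contra h
    exact MvPolynomial.mem_support_iff.1 hβ (ha β (by omega))
  rw [Finsupp.weight_apply, Finsupp.sum_fintype _ _ (fun i => zero_smul ℕ (wz i)),
    Finset.sum_eq_zero_iff] at h0
  refine Finsupp.ext ?_
  rintro (i | i | i)
  · rw [Finsupp.mapDomain_of_notMem_range _ _ (by simp)]
    simpa [wz, eq_comm] using h0 (iq i) (Finset.mem_univ _)
  · rw [Finsupp.mapDomain_of_notMem_range _ _ (by simp)]
    simpa [wz, eq_comm] using h0 (ip i) (Finset.mem_univ _)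
  · erw [Finsupp.mapDomain_apply iz_injective]
    rfl

/-- The powers of a noncentral element are independent over `P_m`. -/
theorem pow_independent_over_cen {c : Alg K n m} {e : ℕ} (hc : c ∈ afilt K n m wz (e + 2))
    (hc' : c ∉ afilt K n m wz (e + 1)) (N : ℕ) (u : ℕ → Alg K n m)
    (hu : ∀ k, u k ∈ (cen K n m).range)
    (h : ∑ k ∈ Finset.range N, u k * c ^ k = 0) : ∀ k < N, u k = 0 := by
  have hw : ∀ i : Fin n, 0 < wz (iq i : Idx n m) := fun _ => Nat.one_pos
  have hu1 : ∀ k, u k ∈ afilt K n m wz 1 := fun k => by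
    obtain ⟨f, hf⟩ := hu k
    rw [← hf]
    exact cen_mem_afilt_wz f
  induction N with
  | zero => intro k hk; omega
  | succ N ih =>
    have hN : u N = 0 := by
      by_contra h0
      -- Nonzero central coefficients have weight 0 and c has weight exactly e + 1 > 0. The relation
      -- expresses the top term by terms of weight below N(e + 1), but its own weight is N(e + 1)
      -- unless u_N = 0.
      have h1 : u N * c ^ N ∈ afilt K n m wz (0 + N * (e + 1)) := by
        rw [Finset.sum_range_succ, add_comm, add_eq_zero_iff_eq_neg] at h
        rw [h, zero_add]
        refine Submodule.neg_mem _ (Submodule.sum_mem _ fun k hk => ?_)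
        refine afilt_mono _ ?_ (mul_mem_afilt (d := 0) hw (hu1 k) (pow_mem_afilt hw hc k))
        have := Nat.mul_le_mul_right (e + 1) (Nat.succ_le_of_lt (Finset.mem_range.1 hk))
        rw [Nat.succ_mul] at this
        omega
      refine mul_notMem_afilt hw (d := 0) (hu1 N) (fun h => h0 (eq_zero_of_mem_afilt_zero h))
        (pow_mem_afilt hw hc N) (pow_notMem_afilt hw hc hc' N) h1
    rw [Finset.sum_range_succ, hN, zero_mul, add_zero] at h
    intro k hk
    rcases Nat.lt_succ_iff_lt_or_eq.1 hk with hk | rfl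
    · exact ih h k hk
    · exact hN

theorem exists_mem_afilt (a : Alg K n m) : ∃ d, a ∈ afilt K n m (fun _ => 1) d :=
  exists_mem_filt _ _

/-- The centralizer of the image of the Weyl algebra under an endomorphism is the centre. -/
theorem exists_cen_eq_of_commute [CharZero K] (σ : Alg K n m →ₐ[K] Alg K n m) {c : Alg K n m}
    (hc : ∀ i, innerPartial σ i c = 0) : ∃ f, cen K n m f = c := by
  by_contra hcen
  have hc0 : c ≠ 0 := fun h => hcen ⟨0, by rw [map_zero, h]⟩
  obtain ⟨e, he, he'⟩ := exists_mem_afilt_of_ne_zero wz hc0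
  obtain _ | e := e
  · exact hcen (exists_cen_eq he)
  choose dg hdg using fun a : Alg K n m => exists_mem_afilt a
  let D := dg c + (∑ l : Fin m, dg (x K n m (iz l)))
    + ∑ i : Fin n ⊕ Fin n, dg (σ (x K n m (inner i)))
  have hDc : c ∈ afilt K n m (fun _ => 1) (D + 1) := afilt_mono _ (by omega) (hdg c)
  have hDz : ∀ l : Fin m, x K n m (iz l) ∈ afilt K n m (fun _ => 1) (D + 1) := fun l => by
    refine afilt_mono _ ?_ (hdg _)
    have := Finset.single_le_sum (f := fun l : Fin m => dg (x K n m (iz l)))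
      (fun _ _ => Nat.zero_le _) (Finset.mem_univ l)
    omega
  have hDi : ∀ i, σ (x K n m (inner i)) ∈ afilt K n m (fun _ => 1) (D + 1) := fun i => by
    refine afilt_mono _ ?_ (hdg _)
    have := Finset.single_le_sum (f := fun i => dg (σ (x K n m (inner i))))
      (fun _ _ => Nat.zero_le _) (Finset.mem_univ i)
    omega
  -- The left side counts the products z^γ c^k σ(x)^β with all exponents at most N. The right side
  -- bounds the dimension of the elements of degree at most (2n + m + 1)ND, where they lie.
  have key : ∀ N : ℕ, (N + 1) ^ (2 * n + m + 1) ≤ ((2 * n + m + 1) * (N * D) + 1) ^ (2 * n + m) := by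
    intro N
    obtain ⟨U, hU, hUdim, hUB, hUD, -⟩ := exists_submodule_slices (pd K n m) isDer_pd
      (fun l => x K n m (iz l)) (fun i j => by
        rw [← cen_X, pd_cen, MvPolynomial.pderiv_X]
        by_cases h : i = j
        · subst h; rw [Pi.single_eq_same, map_one, if_pos rfl]
        · rw [Pi.single_eq_of_ne (Ne.symm h), map_zero, if_neg h]) N D 0 hDz (cen K n m).range (fun l => ⟨MvPolynomial.X l, rfl⟩)
      (Submodule.span K {1}) (by
        rw [Submodule.span_singleton_le_iff_mem]; exact (cen K n m).range.one_mem) (by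
        rw [Submodule.span_singleton_le_iff_mem, zero_mul]; exact one_mem_afilt _) (by
        intro i u hu
        obtain ⟨k, rfl⟩ := Submodule.mem_span_singleton.1 hu
        rw [map_smul, (isDer_pd (K := K) (n := n) i).map_one, smul_zero]) Finset.univ
    have h10 : (1 : Alg K n m) ≠ 0 := fun h => one_notMem_afilt (K := K) (n := n) (m := m)
      (fun _ => 1) (by rw [h]; exact Submodule.zero_mem _)
    rw [finrank_span_singleton h10, mul_one, Finset.card_univ, Fintype.card_fin] at hUdim
    rw [Finset.card_univ, Fintype.card_fin, zero_add] at hUD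
    -- No slice derivation is at hand for c, so its powers are separated by the weight `wz`. The
    -- space V they generate is still killed by the inner derivations, since c and the central
    -- variables commute with σ(A_n).
    obtain ⟨V, hV, hVdim, hle⟩ := exists_submodule_powers U c N fun u hu h =>
      pow_independent_over_cen he he' (N + 1) u (fun k => hUB (hu k)) h
    obtain ⟨W, hW, hWdim, -, hWD, -⟩ := exists_submodule_slices (innerPartial σ)
      (isDer_innerPartial σ) (fun i => σ (x K n m (inner i))) (innerPartial_x σ) N D (m + 1) hDi ⊤
      (fun _ => Algebra.mem_top) V (fun v _ => Algebra.mem_top (R := K) (x := v))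
      (hle _ fun k hk u hu => mul_pow_mem_afilt hk (hUD hu) hDc) (by
        intro i
        refine hle (LinearMap.ker (innerPartial σ i)) fun k _ u hu => ?_
        obtain ⟨f, hf⟩ := hUB hu
        have hz : innerPartial σ i u = 0 := by
          rw [← hf]
          rcases i with i | i
          · exact ad_eq_zero_of_commute (cen_commutes f _).symm
          · rw [innerPartial, LinearMap.neg_apply, neg_eq_zero]
            exact ad_eq_zero_of_commute (cen_commutes f _).symm
        rw [LinearMap.mem_ker, isDer_innerPartial σ i, hz, zero_mul, zero_add,
          (isDer_innerPartial σ i).map_pow_of_eq_zero (hc i), mul_zero]) Finset.univ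
    have hfin := Submodule.finrank_mono hWD
    rw [finrank_afilt, hWdim, hVdim, hUdim, Finset.card_univ, Fintype.card_sum,
      Fintype.card_fin] at hfin
    have e1 : m + 1 + (n + n) = 2 * n + m + 1 := by ring
    have e2 : (N + 1) ^ (n + n) * ((N + 1) * (N + 1) ^ m) = (N + 1) ^ (2 * n + m + 1) := by ring
    have e3 : ∀ a b : ℕ, (a + b).choose b = (b + a).choose a := fun a b => by
      rw [add_comm a b]; exact Nat.choose_symm_add
    rw [e1, e2, e3] at hfin
    exact hfin.trans (Nat.choose_add_le_add_one_pow _ _)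
  -- The two sides of `key` grow like N^{s+1} and N^s. For B = (s + 1)D + 1 and N = B^s, the base on
  -- the right is (B - 1)B^s + 1 ≤ B(B^s + 1), and cancelling (B^s + 1)^s leaves B^s + 1 ≤ B^s.
  generalize 2 * n + m = s at key
  set B := (s + 1) * D + 1 with hB
  have h1 : (B ^ s + 1) ^ s * (B ^ s + 1) ≤ (B ^ s + 1) ^ s * B ^ s := by
    rw [← pow_succ, ← mul_pow]
    refine (key (B ^ s)).trans (Nat.pow_le_pow_left ?_ s)
    have : (s + 1) * (B ^ s * D) + 1 = (B - 1) * B ^ s + 1 := by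
      rw [hB, Nat.add_sub_cancel]; ring
    rw [this]
    have h2 : 1 ≤ B := by omega
    obtain ⟨b, hb⟩ := Nat.exists_eq_add_of_le h2
    rw [hb, Nat.add_sub_cancel_left]
    nlinarith [Nat.zero_le ((1 + b) ^ s)]
  have h3 := Nat.le_of_mul_le_mul_left h1 (by positivity)
  omega

end Growth

/-! ### Locally nilpotent derivations with slices. -/

section LocallyNilpotent

variable {K A : Type*} [Field K] [Ring A] [Algebra K A]

/-- Each of the two Leibniz terms lowers one of the exponents k, l, so induction on their sum
suffices and no binomial formula is needed. An exponent 0 means that the factor itself vanishes. -/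
theorem IsDer.pow_mul_eq_zero {δ : A →ₗ[K] A} (hδ : IsDer δ) (s : ℕ) :
    ∀ (k l : ℕ) (a b : A), k + l = s → (δ ^ k) a = 0 → (δ ^ l) b = 0 → (δ ^ s) (a * b) = 0 := by
  induction s with
  | zero =>
    intro k l a b h ha hb
    obtain rfl : k = 0 := by omega
    rw [pow_zero, Module.End.one_apply] at ha ⊢
    rw [ha, zero_mul]
  | succ s ih =>
    intro k l a b h ha hb
    rw [pow_succ, Module.End.mul_apply, hδ, map_add]
    have h1 : (δ ^ s) (δ a * b) = 0 := by
      rcases k with _ | k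
      · rw [pow_zero, Module.End.one_apply] at ha
        rw [ha, map_zero, zero_mul, map_zero]
      · rw [pow_succ, Module.End.mul_apply] at ha
        exact ih k l _ _ (by omega) ha hb
    have h2 : (δ ^ s) (a * δ b) = 0 := by
      rcases l with _ | l
      · rw [pow_zero, Module.End.one_apply] at hb
        rw [hb, map_zero, mul_zero, map_zero]
      · rw [pow_succ, Module.End.mul_apply] at hb
        exact ih k l _ _ (by omega) ha hb
    rw [h1, h2, add_zero]

theorem pow_apply_eq_zero_of_le {δ : A →ₗ[K] A} {a : A} {k l : ℕ} (h : k ≤ l)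
    (ha : (δ ^ k) a = 0) : (δ ^ l) a = 0 := by
  obtain ⟨r, rfl⟩ := Nat.exists_eq_add_of_le h
  rw [add_comm, pow_add, Module.End.mul_apply, ha, map_zero]

/-- A derivation is locally nilpotent if it is nilpotent on generators. -/
theorem IsDer.isLocallyNilpotent {δ : A →ₗ[K] A} (hδ : IsDer δ) {S : Set A}
    (hS : Algebra.adjoin K S = ⊤) (h : ∀ a ∈ S, ∃ k : ℕ, (δ ^ k) a = 0) :
    IsLocallyNilpotent δ := by
  intro a
  have ha : a ∈ Algebra.adjoin K S := by rw [hS]; exact Algebra.mem_top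
  induction ha using Algebra.adjoin_induction with
  | mem a ha => exact h a ha
  | algebraMap r =>
    exact ⟨1, by rw [pow_one, Algebra.algebraMap_eq_smul_one, map_smul, hδ.map_one, smul_zero]⟩
  | add a b _ _ ha hb =>
    obtain ⟨k, hk⟩ := ha
    obtain ⟨l, hl⟩ := hb
    exact ⟨k + l, by rw [map_add, pow_apply_eq_zero_of_le (Nat.le_add_right k l) hk,
      pow_apply_eq_zero_of_le (Nat.le_add_left l k) hl, add_zero]⟩
  | mul a b _ _ ha hb =>
    obtain ⟨k, hk⟩ := ha
    obtain ⟨l, hl⟩ := hb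
    exact ⟨k + l, hδ.pow_mul_eq_zero _ k l a b rfl hk hl⟩

theorem IsDer.pow_apply_slice_pow {δ : A →ₗ[K] A} (hδ : IsDer δ) {y b : A} (hy : δ y = 1)
    (hb : δ b = 0) (k : ℕ) : (δ ^ k) (b * y ^ k) = ((k.factorial : ℕ) : K) • b := by
  induction k with
  | zero => simp
  | succ k ih =>
    rw [pow_succ, Module.End.mul_apply, hδ, hb, zero_mul, zero_add, hδ.map_slice_pow hy,
      mul_smul_comm, map_smul, ih, smul_smul, Nat.factorial_succ, Nat.cast_mul]

/-- An algebra with commuting locally nilpotent derivations and dual slices is generated by the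
slices and the constants. -/
theorem mem_of_slices [CharZero K] {ι : Type*} [Fintype ι] [DecidableEq ι]
    (δ : ι → A →ₗ[K] A) (hδ : ∀ i, IsDer (δ i)) (hc : ∀ i j a, δ i (δ j a) = δ j (δ i a))
    (hn : ∀ i, IsLocallyNilpotent (δ i)) (y : ι → A)
    (hy : ∀ i j, δ i (y j) = if i = j then 1 else 0) (B : Subalgebra K A) (hyB : ∀ i, y i ∈ B)
    (hB : ∀ a, (∀ i, δ i a = 0) → a ∈ B) (a : A) : a ∈ B := by
  have key : ∀ (J : Finset ι) (a : A), (∀ i ∉ J, δ i a = 0) → a ∈ B := by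
    intro J
    induction J using Finset.induction_on with
    | empty => exact fun a ha => hB a fun i => ha i (Finset.notMem_empty i)
    | insert j J hj ih =>
      intro a ha
      obtain ⟨k, hk⟩ := hn j a
      induction k generalizing a with
      | zero =>
        rw [pow_zero, Module.End.one_apply] at hk
        rw [hk]
        exact B.zero_mem
      | succ k ihk =>
        have hjb : δ j ((δ j ^ k) a) = 0 := by
          rw [← Module.End.mul_apply, ← pow_succ']; exact hk
        have hib : ∀ i ∉ insert j J, δ i ((δ j ^ k) a) = 0 := by
          intro i hi
          have : Commute (δ i) (δ j) := LinearMap.ext fun a => hc i j a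
          have h2 := congrArg (fun F : A →ₗ[K] A => F a) (this.pow_right k).eq
          simp only [Module.End.mul_apply] at h2
          rw [h2, ha i hi, map_zero]
        have hbB : (δ j ^ k) a ∈ B := by
          refine ih _ fun i hi => ?_
          by_cases hij : i = j
          · rw [hij, hjb]
          · exact hib i (by rw [Finset.mem_insert, not_or]; exact ⟨hij, hi⟩)
        -- The Taylor term of top order: δ_j^k maps b y_j^k to k! b when δ_j b = 0. Subtracting this
        -- term from a lowers the nilpotency order of a under δ_j.
        have hmem : ((k.factorial : ℕ) : K)⁻¹ • ((δ j ^ k) a * y j ^ k) ∈ B :=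
          B.smul_mem (B.mul_mem hbB (B.pow_mem (hyB j) k)) _
        have hsub : a - ((k.factorial : ℕ) : K)⁻¹ • ((δ j ^ k) a * y j ^ k) ∈ B := by
          refine ihk _ (fun i hi => ?_) ?_
          · have hij : i ≠ j := fun h => hi (h ▸ Finset.mem_insert_self j J)
            rw [map_sub, ha i hi, map_smul, hδ i, hib i hi, zero_mul, zero_add,
              (hδ i).map_pow_of_eq_zero (by rw [hy, if_neg hij]), mul_zero, smul_zero, sub_zero]
          · rw [map_sub, map_smul, (hδ j).pow_apply_slice_pow (by rw [hy, if_pos rfl]) hjb,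
              smul_smul, inv_mul_cancel₀ (Nat.cast_ne_zero.2 (Nat.factorial_ne_zero k)), one_smul,
              sub_self]
        have := B.add_mem hsub hmem
        rwa [sub_add_cancel] at this
  exact key Finset.univ a fun i hi => absurd (Finset.mem_univ i) hi

/-- The Jacobi identity: the difference of the two sides is [[a,b],c]. -/
theorem ad_ad_comm_aux (a b c : A) (h : (a * b - b * a) * c = c * (a * b - b * a)) :
    a * (b * c - c * b) - (b * c - c * b) * a = b * (a * c - c * a) - (a * c - c * a) * b := by
  rw [← sub_eq_zero] at h ⊢
  rw [← h]
  noncomm_ring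

end LocallyNilpotent

/-! ### Polynomial maps with constant nonzero Jacobian. -/

section Polynomial

variable {K : Type*} [Field K] {m : ℕ}

/-- A polynomial with vanishing gradient is constant. -/
theorem eq_C_of_pderiv_eq_zero [CharZero K] {ι : Type*} (f : MvPolynomial ι K)
    (h : ∀ i, MvPolynomial.pderiv i f = 0) : f = MvPolynomial.C (f.coeff 0) := by
  classical
  ext β
  rw [MvPolynomial.coeff_C]
  split_ifs with hβ
  · rw [hβ]
  · obtain ⟨i, hi⟩ : ∃ i, β i ≠ 0 := by
      by_contra! hall
      exact hβ (Finsupp.ext fun i => (hall i).symm)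
    have h1 := congrArg (MvPolynomial.coeff (β - Finsupp.single i 1)) (h i)
    rw [MvPolynomial.coeff_pderiv, MvPolynomial.coeff_zero, tsub_add_cancel_of_le
      (by rw [Finsupp.single_le_iff]; omega)] at h1
    refine (mul_eq_zero.1 h1).resolve_right ?_
    exact Nat.cast_add_one_ne_zero _

/-- The Jacobian matrix of a tuple of polynomials. -/
noncomputable def polyJac (F : Fin m → MvPolynomial (Fin m) K) :
    Matrix (Fin m) (Fin m) (MvPolynomial (Fin m) K) :=
  Matrix.of fun k l => MvPolynomial.pderiv l (F k)

/-- The derivation dual to `F_j` among the `F_k`. -/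
noncomputable def dualDer (F : Fin m → MvPolynomial (Fin m) K) (Δ : Kˣ) (j : Fin m) :
    Derivation K (MvPolynomial (Fin m) K) (MvPolynomial (Fin m) K) :=
  ∑ l, ((Δ⁻¹ : Kˣ).val • (polyJac F).transpose.adjugate j l) • MvPolynomial.pderiv l

theorem dualDer_eq_sum (F : Fin m → MvPolynomial (Fin m) K) (Δ : Kˣ) (j : Fin m)
    (f : MvPolynomial (Fin m) K) : dualDer F Δ j f
      = ∑ l, ((Δ⁻¹ : Kˣ).val • (polyJac F).transpose.adjugate j l) * MvPolynomial.pderiv l f := by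
  rw [dualDer, ← Derivation.coeFnAddMonoidHom_apply, map_sum, Finset.sum_apply]
  rfl

/-- Cramer's rule: expansion along the replaced row has the entries of the adjugate as coefficients.
The sum form makes the derivation property evident, the determinant form gives duality with the F_k.
-/
theorem dualDer_apply (F : Fin m → MvPolynomial (Fin m) K) (Δ : Kˣ) (j : Fin m)
    (f : MvPolynomial (Fin m) K) : dualDer F Δ j f
      = (Δ⁻¹ : Kˣ).val • ((polyJac F).updateRow j fun l => MvPolynomial.pderiv l f).det := by
  rw [← Matrix.cramer_transpose_apply, Matrix.cramer_eq_adjugate_mulVec, dualDer_eq_sum,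
    Matrix.mulVec, dotProduct, Finset.smul_sum]
  simp only [smul_mul_assoc]

variable {F : Fin m → MvPolynomial (Fin m) K} {Δ : Kˣ}

theorem dualDer_self (hF : (polyJac F).det = MvPolynomial.C (Δ : K)) (i j : Fin m) :
    dualDer F Δ i (F j) = if i = j then 1 else 0 := by
  rw [dualDer_apply]
  have hrow : (fun l => MvPolynomial.pderiv l (F j)) = polyJac F j := rfl
  split_ifs with h
  · subst h
    rw [hrow, Matrix.updateRow_eq_self, hF, MvPolynomial.smul_eq_C_mul, ← map_mul,
      Units.inv_mul, map_one]
  · rw [Matrix.det_zero_of_row_eq h, smul_zero]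
    rw [Matrix.updateRow_self, Matrix.updateRow_ne (Ne.symm h), hrow]

theorem derivation_apply_eq_sum (D : Derivation K (MvPolynomial (Fin m) K)
    (MvPolynomial (Fin m) K)) (f : MvPolynomial (Fin m) K) :
    D f = ∑ l, MvPolynomial.pderiv l f * D (MvPolynomial.X l) := by
  have h : D = ∑ l, D (MvPolynomial.X l) • MvPolynomial.pderiv l := by
    apply MvPolynomial.derivation_ext
    intro i
    rw [← Derivation.coeFnAddMonoidHom_apply (∑ l, _), map_sum, Finset.sum_apply,
      Finset.sum_eq_single i]
    · simp
    · intro l _ hl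
      simp [MvPolynomial.pderiv_X_of_ne (Ne.symm hl)]
    · simp
  conv_lhs => rw [h]
  rw [← Derivation.coeFnAddMonoidHom_apply (∑ l, _), map_sum, Finset.sum_apply]
  exact Finset.sum_congr rfl fun l _ => mul_comm _ _

theorem isUnit_polyJac_det (hF : (polyJac F).det = MvPolynomial.C (Δ : K)) :
    IsUnit (polyJac F).det := by
  rw [hF]
  exact Δ.isUnit.map MvPolynomial.C

/-- By the chain rule the invertible Jacobian matrix kills the vector of the D(X_l). Applied to
commutators, this shows that the dual derivations commute. -/
theorem derivation_eq_zero_of_apply_eq_zero (hF : (polyJac F).det = MvPolynomial.C (Δ : K))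
    (D : Derivation K (MvPolynomial (Fin m) K) (MvPolynomial (Fin m) K))
    (hD : ∀ k, D (F k) = 0) : D = 0 := by
  have h : (polyJac F).mulVec (fun l => D (MvPolynomial.X l)) = 0 := by
    funext k
    rw [Pi.zero_apply, ← hD k, derivation_apply_eq_sum]
    rfl
  have h2 := congrArg (polyJac F)⁻¹.mulVec h
  rw [Matrix.mulVec_mulVec, Matrix.nonsing_inv_mul _ (isUnit_polyJac_det hF), Matrix.one_mulVec,
    Matrix.mulVec_zero] at h2
  apply MvPolynomial.derivation_ext
  intro l
  exact congrFun h2 l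

theorem dualDer_comm (hF : (polyJac F).det = MvPolynomial.C (Δ : K)) (i j : Fin m)
    (f : MvPolynomial (Fin m) K) :
    dualDer F Δ i (dualDer F Δ j f) = dualDer F Δ j (dualDer F Δ i f) := by
  have h : ⁅dualDer F Δ i, dualDer F Δ j⁆ = 0 := by
    apply derivation_eq_zero_of_apply_eq_zero hF
    intro k
    rw [Derivation.commutator_apply, dualDer_self hF, dualDer_self hF]
    split_ifs <;> simp
  have h2 := congrArg (fun D => D f) h
  simpa [Derivation.commutator_apply, sub_eq_zero] using h2

/-- The hypothesis says that the adjugate kills the gradient; multiplying by the transposed Jacobian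
gives Δ times the gradient. -/
theorem pderiv_eq_zero_of_dualDer_eq_zero (hF : (polyJac F).det = MvPolynomial.C (Δ : K))
    {f : MvPolynomial (Fin m) K} (hf : ∀ j, dualDer F Δ j f = 0) (l : Fin m) :
    MvPolynomial.pderiv l f = 0 := by
  have h : (polyJac F).transpose.adjugate.mulVec (fun l => MvPolynomial.pderiv l f) = 0 := by
    funext j
    have h1 := hf j
    rw [dualDer_apply, ← Matrix.cramer_transpose_apply, Matrix.cramer_eq_adjugate_mulVec] at h1
    exact (smul_eq_zero.1 h1).resolve_left (Units.ne_zero _)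
  have h2 := congrArg (polyJac F).transpose.mulVec h
  rw [Matrix.mulVec_mulVec, Matrix.mul_adjugate, Matrix.det_transpose, hF, Matrix.mulVec_zero,
    Matrix.smul_mulVec, Matrix.one_mulVec] at h2
  have h3 := congrFun h2 l
  rw [Pi.smul_apply, Pi.zero_apply, smul_eq_mul] at h3
  exact (mul_eq_zero.1 h3).resolve_left 
    (mt MvPolynomial.C_eq_zero.1 (Units.ne_zero Δ))

theorem isDer_of_derivation (D : Derivation K (MvPolynomial (Fin m) K)
    (MvPolynomial (Fin m) K)) : IsDer D.toLinearMap := by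
  intro a b
  rw [Derivation.coeFn_coe, Derivation.leibniz, smul_eq_mul, smul_eq_mul]
  ring

/-- If the derivations dual to an endomorphism of a polynomial algebra with constant nonzero
Jacobian are locally nilpotent then the endomorphism is surjective. -/
theorem surjective_of_isLocallyNilpotent [CharZero K]
    (φ : MvPolynomial (Fin m) K →ₐ[K] MvPolynomial (Fin m) K)
    (hF : (polyJac fun k => φ (MvPolynomial.X k)).det = MvPolynomial.C (Δ : K))
    (hn : ∀ j, IsLocallyNilpotent (dualDer (fun k => φ (MvPolynomial.X k)) Δ j).toLinearMap) :
    Function.Surjective φ := by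
  intro f
  refine mem_of_slices _ (fun j => isDer_of_derivation _) (fun i j a => dualDer_comm hF i j a) hn
    (fun k => φ (MvPolynomial.X k)) (fun i j => dualDer_self hF i j) φ.range
    (fun i => ⟨_, rfl⟩) (fun a ha => ?_) f
  rw [eq_C_of_pderiv_eq_zero a (pderiv_eq_zero_of_dualDer_eq_zero hF ha)]
  exact φ.range.algebraMap_mem _

/-- The chain rule: dual derivations are conjugate to the partial derivatives. -/
theorem dualDer_algHom (φ : MvPolynomial (Fin m) K →ₐ[K] MvPolynomial (Fin m) K)
    (hF : (polyJac fun k => φ (MvPolynomial.X k)).det = MvPolynomial.C (Δ : K)) (j : Fin m)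
    (f : MvPolynomial (Fin m) K) :
    dualDer (fun k => φ (MvPolynomial.X k)) Δ j (φ f) = φ (MvPolynomial.pderiv j f) := by
  induction f using MvPolynomial.induction_on with
  | C a =>
    rw [← MvPolynomial.algebraMap_eq, AlgHom.commutes, Derivation.map_algebraMap,
      Derivation.map_algebraMap, map_zero]
  | add f g hf hg => rw [map_add, map_add, hf, hg, map_add, map_add]
  | mul_X f k hf =>
    rw [map_mul, Derivation.leibniz, Derivation.leibniz, hf, dualDer_self hF, map_add,
      smul_eq_mul, smul_eq_mul, smul_eq_mul, smul_eq_mul, map_mul, map_mul, MvPolynomial.pderiv_X]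
    by_cases h : j = k
    · subst h; simp
    · rw [if_neg h, Pi.single_eq_of_ne (Ne.symm h), map_zero]

end Polynomial

/-! ### Restriction of σ to the centre, and the central derivations. -/

section Centre

variable {K : Type*} [Field K] {n m : ℕ}

theorem cen_injective : Function.Injective (cen K n m) := by
  intro f g h
  have h2 := congrArg (symb K n m) h
  rw [symb_cen, symb_cen] at h2
  exact MvPolynomial.rename_injective _ iz_injective h2

theorem innerPartial_cen (σ : Alg K n m →ₐ[K] Alg K n m) (i) (f : MvPolynomial (Fin m) K) :
    innerPartial σ i (cen K n m f) = 0 := by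
  rcases i with i | i
  · exact ad_eq_zero_of_commute (cen_commutes f _).symm
  · rw [innerPartial, LinearMap.neg_apply, neg_eq_zero]
    exact ad_eq_zero_of_commute (cen_commutes f _).symm

theorem innerPartial_map (σ : Alg K n m →ₐ[K] Alg K n m) (i) (a : Alg K n m) :
    innerPartial σ i (σ a) = σ (innerPartial (AlgHom.id K _) i a) := by
  rcases i with i | i
  · exact ad_map σ _ _
  · rw [innerPartial, innerPartial, LinearMap.neg_apply, LinearMap.neg_apply, map_neg, ad_map]
    rfl

variable [CharZero K]

/-- The image of a central element commutes with σ(A_n), whose centralizer is P_m. -/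
theorem exists_cen_eq_map_cen (σ : Alg K n m →ₐ[K] Alg K n m) (f : MvPolynomial (Fin m) K) :
    ∃ g, cen K n m g = σ (cen K n m f) :=
  exists_cen_eq_of_commute σ fun i => by rw [innerPartial_map, innerPartial_cen, map_zero]

/-- The restriction of an endomorphism of `A` to the centre. -/
noncomputable def cenEnd (σ : Alg K n m →ₐ[K] Alg K n m) :
    MvPolynomial (Fin m) K →ₐ[K] MvPolynomial (Fin m) K :=
  MvPolynomial.aeval fun k => (exists_cen_eq_map_cen σ (MvPolynomial.X k)).choose

theorem cen_cenEnd (σ : Alg K n m →ₐ[K] Alg K n m) (f : MvPolynomial (Fin m) K) :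
    cen K n m (cenEnd σ f) = σ (cen K n m f) := by
  have h : (cen K n m).comp (cenEnd σ) = σ.comp (cen K n m) := by
    apply MvPolynomial.algHom_ext
    intro k
    rw [AlgHom.comp_apply, AlgHom.comp_apply, cenEnd, MvPolynomial.aeval_X]
    exact (exists_cen_eq_map_cen σ (MvPolynomial.X k)).choose_spec
  exact congrArg (fun F => F f) h

theorem ldet_map {R S : Type*} [Ring R] [Ring S] (f : R →+* S) {r : ℕ}
    (M : Matrix (Fin r) (Fin r) R) : ldet (M.map f) = f (ldet M) := by
  rw [ldet, ldet, map_sum]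
  refine Finset.sum_congr rfl fun τ _ => ?_
  rw [Units.smul_def, Units.smul_def, map_zsmul, map_list_prod, List.map_ofFn]
  rfl

theorem ofFn_update_mul_prod {R : Type*} [Ring R] {r : ℕ} (f : Fin r → R) (j : Fin r) (W : R)
    (hW : ∀ i, W * f i = f i * W) :
    (List.ofFn (Function.update f j (W * f j))).prod = W * (List.ofFn f).prod := by
  induction r with
  | zero => exact j.elim0
  | succ r ih =>
    rw [List.ofFn_succ, List.ofFn_succ, List.prod_cons, List.prod_cons]
    refine Fin.cases ?_ (fun j => ?_) j
    · rw [Function.update_self, mul_assoc]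
      congr 3
    · rw [Function.update_of_ne (Fin.succ_ne_zero j).symm]
      have : (fun i : Fin r => Function.update f j.succ (W * f j.succ) i.succ)
          = Function.update (fun i : Fin r => f i.succ) j (W * f j.succ) := by
        funext i
        by_cases h : i = j
        · subst h; simp
        · rw [Function.update_of_ne h, Function.update_of_ne (by simpa using h)]
      rw [this, ih (fun i => f i.succ) j fun i => hW i.succ, ← mul_assoc, ← hW, mul_assoc]

theorem ldet_updateRow_mul {R : Type*} [Ring R] {r : ℕ} (M : Matrix (Fin r) (Fin r) R) (j : Fin r)
    (u : Fin r → R) (W : R) (hM : ∀ i k, W * M i k = M i k * W) (hu : ∀ k, W * u k = u k * W) :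
    ldet (M.updateRow j fun k => W * u k) = W * ldet (M.updateRow j u) := by
  rw [ldet, ldet, Finset.mul_sum]
  refine Finset.sum_congr rfl fun τ _ => ?_
  rw [mul_smul_comm, ← ofFn_update_mul_prod _ j W]
  · congr 3
    funext i
    by_cases h : i = j
    · subst h; simp
    · simp [h]
  · intro i
    by_cases h : i = j
    · subst h; simp [hu]
    · simp [h, hM]

theorem jac_eq_map (σ : Alg K n m →ₐ[K] Alg K n m) :
    jac σ = (polyJac fun k => cenEnd σ (MvPolynomial.X k)).map (cen K n m).toRingHom := by
  ext k l
  rw [jac, Matrix.of_apply, ← cen_X, ← cen_cenEnd, pd_cen]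
  rfl

variable {σ : Alg K n m →ₐ[K] Alg K n m} {Δ : Kˣ}

theorem polyJac_cenEnd_det (hΔ : ldet (jac σ) = algebraMap K (Alg K n m) (Δ : K)) :
    (polyJac fun k => cenEnd σ (MvPolynomial.X k)).det = MvPolynomial.C (Δ : K) := by
  rw [jac_eq_map, ldet_map, ldet_eq_det] at hΔ
  apply cen_injective (n := n)
  rw [← MvPolynomial.algebraMap_eq, AlgHom.commutes]
  exact hΔ

-- All rows are central apart from the factor w, which can be pulled out of the replaced row. What
-- remains is a genuine determinant over P_m.
variable (σ Δ) in
theorem centralPartial_weyl_mul_cen (j : Fin m) (w : Weyl K n) (f : MvPolynomial (Fin m) K) :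
    centralPartial σ Δ j (weylIncl K n m w * cen K n m f)
      = weylIncl K n m w
        * cen K n m (dualDer (fun k => cenEnd σ (MvPolynomial.X k)) Δ j f) := by
  have e1 : ∀ l, pd K n m l (weylIncl K n m w * cen K n m f)
      = weylIncl K n m w * cen K n m (MvPolynomial.pderiv l f) := fun l => by
    rw [pd_weyl_mul, pd_cen]
  change (Δ⁻¹ : Kˣ).val • ldet ((jac σ).updateRow j fun l =>
    pd K n m l (weylIncl K n m w * cen K n m f)) = _
  simp only [e1]
  rw [ldet_updateRow_mul (jac σ) j (fun l => cen K n m (MvPolynomial.pderiv l f)) (weylIncl K n m w)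
    (fun i k => by rw [jac_eq_map]; exact (cen_commutes _ _).symm)
    (fun k => (cen_commutes _ _).symm)]
  have e2 : (jac σ).updateRow j (fun l => cen K n m (MvPolynomial.pderiv l f))
      = ((polyJac fun k => cenEnd σ (MvPolynomial.X k)).updateRow j
        fun l => MvPolynomial.pderiv l f).map (cen K n m).toRingHom := by
    rw [jac_eq_map]
    ext i l
    by_cases h : i = j
    · subst h; simp
    · simp [h]
  rw [e2, ldet_map, ldet_eq_det, dualDer_apply, map_smul, mul_smul_comm]
  rfl

-- As a combination of the derivations `pd` with central coefficients, `centralPartial` is itself a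
-- derivation, which its determinantal form over a noncommutative ring does not show.
variable (σ Δ) in
theorem centralPartial_eq_sum (j : Fin m) (a : Alg K n m) :
    centralPartial σ Δ j a = ∑ l, cen K n m ((Δ⁻¹ : Kˣ).val •
      (polyJac fun k => cenEnd σ (MvPolynomial.X k)).transpose.adjugate j l) * pd K n m l a := by
  induction a using TensorProduct.induction_on with
  | zero => simp
  | add a b ha hb =>
    rw [map_add, ha, hb, ← Finset.sum_add_distrib]
    exact Finset.sum_congr rfl fun l _ => by rw [map_add, mul_add]
  | tmul w f =>
    have e : w ⊗ₜ[K] f = weylIncl K n m w * cen K n m f := by simp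
    rw [e, centralPartial_weyl_mul_cen, dualDer_eq_sum, map_sum, Finset.mul_sum]
    refine Finset.sum_congr rfl fun l _ => ?_
    rw [pd_weyl_mul, pd_cen, map_mul, ← mul_assoc, ← mul_assoc, cen_commutes]

variable (σ Δ) in
theorem isDer_centralPartial (j : Fin m) : IsDer (centralPartial σ Δ j) := by
  intro a b
  rw [centralPartial_eq_sum, centralPartial_eq_sum, centralPartial_eq_sum, Finset.sum_mul,
    Finset.mul_sum, ← Finset.sum_add_distrib]
  refine Finset.sum_congr rfl fun l _ => ?_
  rw [isDer_pd l, mul_add, mul_assoc, ← mul_assoc a, ← cen_commutes, mul_assoc]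

variable (σ Δ) in
theorem isDer_partial' (i : Idx n m) : IsDer (partial' σ Δ i) := by
  rcases i with i | i | i
  · exact isDer_ad _
  · exact (isDer_ad _).neg
  · exact isDer_centralPartial σ Δ i

variable (σ Δ) in
theorem centralPartial_pow_cen (j : Fin m) (k : ℕ) (f : MvPolynomial (Fin m) K) :
    (centralPartial σ Δ j ^ k) (cen K n m f) = cen K n m
      (((dualDer (fun k => cenEnd σ (MvPolynomial.X k)) Δ j).toLinearMap ^ k) f) := by
  induction k generalizing f with
  | zero => rfl
  | succ k ih =>
    rw [pow_succ, pow_succ, Module.End.mul_apply, Module.End.mul_apply, ← ih]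
    congr 1
    have := centralPartial_weyl_mul_cen σ Δ j 1 f
    rwa [map_one, one_mul, one_mul] at this

-- Commutators of the generators q_i, p_i are scalars, hence so are those of their images, and the
-- Jacobi identity applies.
omit [CharZero K] in
theorem innerPartial_comm (σ : Alg K n m →ₐ[K] Alg K n m) (i j) (a : Alg K n m) :
    innerPartial σ i (innerPartial σ j a) = innerPartial σ j (innerPartial σ i a) := by
  have key : ∀ k l : Fin n ⊕ Fin n, ad (σ (x K n m (inner k))) (ad (σ (x K n m (inner l))) a)
      = ad (σ (x K n m (inner l))) (ad (σ (x K n m (inner k))) a) := by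
    intro k l
    refine ad_ad_comm_aux _ _ _ ?_
    rw [← map_mul, ← map_mul, ← map_sub]
    have : ∃ c : K, x K n m (inner k) * x K n m (inner l) - x K n m (inner l) * x K n m (inner k)
        = algebraMap K _ c := by
      rcases k with k | k <;> rcases l with l | l <;> rw [inner, inner]
      · exact ⟨0, by rw [map_zero, x_qq, sub_self]⟩
      · refine ⟨-if l = k then 1 else 0, ?_⟩
        rw [← neg_sub, x_pq]
        split_ifs
        · rw [map_neg, map_one]
        · rw [neg_zero, map_neg, map_zero, neg_zero]
      · refine ⟨if k = l then 1 else 0, ?_⟩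
        rw [x_pq]
        split_ifs
        · rw [map_one]
        · rw [map_zero]
      · exact ⟨0, by rw [map_zero, x_pp, sub_self]⟩
    obtain ⟨c, hc⟩ := this
    rw [hc, AlgHom.commutes]
    exact Algebra.commutes c a
  rcases i with i | i <;> rcases j with j | j <;>
    simp only [innerPartial, LinearMap.neg_apply, map_neg]
  · exact key (Sum.inr i) (Sum.inr j)
  · rw [neg_inj]; exact key (Sum.inr i) (Sum.inl j)
  · rw [neg_inj]; exact key (Sum.inl i) (Sum.inr j)
  · exact congrArg _ (congrArg _ (key (Sum.inl i) (Sum.inl j)))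

end Centre

/-! ### Binomial estimates for the degree bound. -/

section Numerics

/-- By Pascal's rule each of the E unit steps from N to N + E adds at least C(r+N, N). -/
theorem choose_add_mul_le (r N E : ℕ) :
    (r + 1 + N).choose N + E * (r + N).choose N ≤ (r + 1 + (N + E)).choose (N + E) := by
  induction E with
  | zero => simp
  | succ E ih =>
    have h1 : (r + 1 + (N + (E + 1))).choose (N + (E + 1))
        = (r + 1 + (N + E)).choose (N + E) + (r + (N + (E + 1))).choose (N + (E + 1)) := by
      have e1 : r + 1 + (N + (E + 1)) = (r + 1 + (N + E)) + 1 := by ring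
      have e2 : r + (N + (E + 1)) = r + 1 + (N + E) := by ring
      rw [e1, e2, ← add_assoc N E 1, Nat.choose_succ_succ]
    have h2 : (r + N).choose N ≤ (r + (N + (E + 1))).choose (N + (E + 1)) := by
      rw [← Nat.choose_symm_add, ← Nat.choose_symm_add]
      exact Nat.choose_le_choose r (by omega)
    rw [h1, Nat.succ_mul]
    omega

/-- After multiplication by r!, the binomial C(r+N, r) is at least N^r and C(r+M, r) is at most
(r+M)^r. -/
theorem mul_pow_le_of_choose_le {r E N M : ℕ} (h : E * (r + N).choose N ≤ (r + M).choose M) :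
    E * N ^ r ≤ (r + M) ^ r := by
  rw [← Nat.choose_symm_add, ← Nat.choose_symm_add] at h
  have h1 : N ^ r ≤ r.factorial * (r + N).choose r := by
    rw [← Nat.descFactorial_eq_factorial_mul_choose]
    exact (Nat.pow_le_pow_left (by omega) r).trans (Nat.pow_sub_le_descFactorial (r + N) r)
  have h2 : r.factorial * (r + M).choose r ≤ (r + M) ^ r := by
    rw [← Nat.descFactorial_eq_factorial_mul_choose]
    exact Nat.descFactorial_le_pow _ _
  calc E * N ^ r ≤ E * (r.factorial * (r + N).choose r) := Nat.mul_le_mul_left _ h1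
    _ = r.factorial * (E * (r + N).choose r) := by ring
    _ ≤ r.factorial * (r + M).choose r := Nat.mul_le_mul_left _ h
    _ ≤ _ := h2

open Filter Topology in
theorem le_pow_of_forall_mul_pow_le {r E d c : ℕ} (h : ∀ N, E * N ^ r ≤ (d * N + c) ^ r) :
    E ≤ d ^ r := by
  have ht : Tendsto (fun N : ℕ => ((d : ℝ) + c / N) ^ r) atTop (𝓝 (((d : ℝ) + 0) ^ r)) :=
    (tendsto_const_nhds.add (tendsto_const_div_atTop_nhds_zero_nat (c : ℝ))).pow r
  rw [add_zero] at ht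
  have hle : (E : ℝ) ≤ (d : ℝ) ^ r := by
    refine ge_of_tendsto ht ?_
    filter_upwards [eventually_gt_atTop 0] with N hN
    have hN' : (0 : ℝ) < N := Nat.cast_pos.2 hN
    have h1 : (E : ℝ) * (N : ℝ) ^ r ≤ ((d : ℝ) * N + c) ^ r := by exact_mod_cast h N
    have h2 : (d : ℝ) + c / N = (d * N + c) / N := by field_simp
    rw [h2, div_pow, le_div_iff₀ (by positivity)]
    exact h1
  exact_mod_cast hle

/-- The difference of the first two binomials is at least E N^r / r!, and the last one is at most
(dN + const)^r / r!. Dividing by N^r and letting N grow compares the leading coefficients E and d^r.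
-/
theorem le_pow_of_forall_choose_le {r E d : ℕ}
    (h : ∀ N, (r + 1 + (N + E)).choose (N + E)
      ≤ (r + 1 + N).choose N + (r + d * (N + E)).choose (d * (N + E))) : E ≤ d ^ r := by
  refine le_pow_of_forall_mul_pow_le (c := r + d * E) fun N => ?_
  have h1 := mul_pow_le_of_choose_le (r := r) (E := E) (N := N) (M := d * (N + E)) (by
    have := choose_add_mul_le r N E
    have := h N
    omega)
  convert h1 using 2
  ring

end Numerics

/-! ### Degree of the inverse of an automorphism. -/

section DegreeBound

variable {K : Type*} [Field K] {n m : ℕ}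

theorem finrank_le_finrank_ker_add_card {A T : Type*} [Ring A] [Algebra K A] [Fintype T]
    (V : Submodule K A) [FiniteDimensional K V] (Θ : V →ₗ[K] T → K) :
    Module.finrank K V ≤ Module.finrank K ((LinearMap.ker Θ).map V.subtype) + Fintype.card T := by
  have h1 := LinearMap.finrank_range_add_finrank_ker Θ
  have h2 : Module.finrank K (LinearMap.range Θ) ≤ Fintype.card T :=
    (Submodule.finrank_le _).trans (by rw [Module.finrank_fintype_fun_eq_card])
  rw [Submodule.finrank_map_subtype_eq]
  omega

/-- An endomorphism of degree at most `d` maps elements of degree at most `M` to elements of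
degree at most `d * M`. -/
theorem map_mem_afilt {σ : Alg K n m →ₐ[K] Alg K n m} {d : ℕ}
    (hd : ∀ i, σ (x K n m i) ∈ afilt K n m (fun _ => 1) (d + 1)) {M : ℕ} {a : Alg K n m}
    (ha : a ∈ afilt K n m (fun _ => 1) (M + 1)) :
    σ a ∈ afilt K n m (fun _ => 1) (d * M + 1) := by
  rw [eq_sum_mono a, map_sum]
  refine Submodule.sum_mem _ fun α hα => ?_
  rw [map_smul]
  refine Submodule.smul_mem _ _ ?_
  have hx : ∀ i, ActsBySymbol (fun _ => 1) (σ (x K n m i) ^ α i) (α i * d) := fun i =>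
    (actsBySymbol_of_mem (fun _ => Nat.one_pos) (hd i)).pow _
  have hmono : ActsBySymbol (fun _ => 1) (σ (mono K n m α)) ((∑ i, α i) * d) := by
    have e : (∑ i, α i) * d = (∑ i, α (iq i) * d) + (∑ i, α (ip i) * d) + ∑ i, α (iz i) * d := by
      rw [Finset.sum_mul, Fintype.sum_sum_type, Fintype.sum_sum_type, add_assoc]
    rw [e, mono, map_mul, map_mul, map_list_prod, map_list_prod, map_list_prod, List.map_ofFn,
      List.map_ofFn, List.map_ofFn]
    simp only [Function.comp_def, map_pow]
    exact ((ActsBySymbol.ofFn_prod fun i => hx _).mul (ActsBySymbol.ofFn_prod fun i => hx _)).mul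
      (ActsBySymbol.ofFn_prod fun i => hx _)
  refine afilt_mono _ ?_ hmono.1
  have hle : ∑ i, α i ≤ M := by
    by_contra h
    refine MvPolynomial.mem_support_iff.1 hα (ha α ?_)
    classical
    rw [weight_one_eq]
    change M + 1 ≤ ∑ i, α i
    omega
  rw [mul_comm d]
  exact Nat.succ_le_succ (Nat.mul_le_mul_right d hle)

theorem exists_X_mul_eq {ι : Type*} {j : ι} {f : MvPolynomial ι K}
    (h : ∀ β : ι →₀ ℕ, β j = 0 → f.coeff β = 0) : ∃ g, f = MvPolynomial.X j * g := by
  have h0 : MvPolynomial.modMonomial f (Finsupp.single j 1) = 0 := by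
    ext β
    by_cases hβ : Finsupp.single j 1 ≤ β
    · rw [MvPolynomial.coeff_modMonomial_of_le _ hβ, MvPolynomial.coeff_zero]
    · rw [MvPolynomial.coeff_modMonomial_of_not_le _ hβ, MvPolynomial.coeff_zero]
      refine h β ?_
      rw [Finsupp.single_le_iff] at hβ
      omega
  exact MvPolynomial.X_dvd_iff_modMonomial_eq_zero.2 h0

theorem x_ne_zero (j : Idx n m) : x K n m j ≠ 0 := by
  intro h
  have := symb_x (K := K) j
  rw [h, map_zero] at this
  exact MvPolynomial.X_ne_zero j this.symm

/-- The degree of the inverse of an automorphism of degree `d` is at most `d ^ (2n + m - 1)`. -/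
theorem symm_x_mem_afilt (e : Alg K n m ≃ₐ[K] Alg K n m) {d : ℕ}
    (hd : ∀ i, e (x K n m i) ∈ afilt K n m (fun _ => 1) (d + 1)) (j : Idx n m) :
    e.symm (x K n m j) ∈ afilt K n m (fun _ => 1) (d ^ (2 * n + m - 1) + 1) := by
  classical
  have hw : ∀ i : Fin n, 0 < (fun _ : Idx n m => 1) (iq i) := fun _ => Nat.one_pos
  have hy0 : e.symm (x K n m j) ≠ 0 := by
    rw [Ne, EmbeddingLike.map_eq_zero_iff]
    exact x_ne_zero j
  obtain ⟨E, hE, hE'⟩ := exists_mem_afilt_of_ne_zero (fun _ => 1) hy0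
  refine afilt_mono _ (Nat.succ_le_succ ?_) hE
  -- L multiplies by y = e⁻¹(x_j), from the side where normal ordering puts x_j: left for q_i, right
  -- for p_i and the central variables. Either way it raises degree by exactly E = deg y.
  obtain ⟨L, hL, hdvd⟩ : ∃ L : Alg K n m →ₗ[K] Alg K n m,
      (∀ (f : ℕ) (b : Alg K n m), b ∈ afilt K n m (fun _ => 1) (f + 1) →
        b ∉ afilt K n m (fun _ => 1) f → L b ∉ afilt K n m (fun _ => 1) (f + E)) ∧
      ∀ a g, symb K n m (e a) = MvPolynomial.X j * g → ∃ b, a = L b := by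
    have hno : ∀ a g, symb K n m (e a) = MvPolynomial.X j * g →
        a = e.symm (normalOrder K n m (MvPolynomial.X j * g)) := fun a g h => by
      rw [← h, normalOrder_symb, AlgEquiv.symm_apply_apply]
    rcases j with j | j
    · refine ⟨LinearMap.mulLeft K (e.symm (x K n m (iq j))), fun f b hb hb' => ?_, fun a g h =>
        ⟨e.symm (normalOrder K n m g), ?_⟩⟩
      · rw [add_comm f]
        exact mul_notMem_afilt hw hE hE' hb hb'
      · rw [hno a g h, normalOrder_q_mul, map_mul]
        rfl
    · refine ⟨LinearMap.mulRight K (e.symm (x K n m (Sum.inr j))), fun f b hb hb' => ?_,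
        fun a g h => ⟨e.symm (normalOrder K n m g), ?_⟩⟩
      · exact mul_notMem_afilt hw hb hb' hE hE'
      · rw [hno a g h, normalOrder_mul, map_mul]
        rfl
  have hs : 2 * n + m = 2 * n + m - 1 + 1 := by
    have : 0 < Fintype.card (Idx n m) := Fintype.card_pos_iff.2 ⟨j⟩
    rw [card_idx] at this
    omega
  refine le_pow_of_forall_choose_le fun N => ?_
  rw [← hs]
  -- T lists the monomials free of X_j that may occur in the symbol of e(a) for deg a ≤ N + E. When
  -- these coefficients vanish, X_j divides that symbol, so a is a multiple of y.
  let T := exps (Finset.univ.erase j) (d * (N + E))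
  let V := afilt K n m (fun _ => 1) (N + E + 1)
  let coords : MvPolynomial (Idx n m) K →ₗ[K] T → K :=
    LinearMap.pi fun β => MvPolynomial.lcoeff K (β : Idx n m →₀ ℕ)
  let Θ : V →ₗ[K] T → K := coords ∘ₗ (symb K n m).toLinearMap ∘ₗ e.toLinearMap ∘ₗ V.subtype
  have hker : (LinearMap.ker Θ).map V.subtype ≤ (afilt K n m (fun _ => 1) (N + 1)).map L := by
    rintro _ ⟨⟨a, ha⟩, hΘ, rfl⟩
    have hea : e a ∈ afilt K n m (fun _ => 1) (d * (N + E) + 1) :=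
      map_mem_afilt (σ := (e : Alg K n m →ₐ[K] Alg K n m)) hd ha
    obtain ⟨g, hg⟩ : ∃ g, symb K n m (e a) = MvPolynomial.X j * g := by
      refine exists_X_mul_eq fun β hβ => ?_
      by_cases hle : Finset.univ.sum β ≤ d * (N + E)
      · have hβT : β ∈ T := by
          rw [mem_exps]
          refine ⟨(Finset.sum_le_univ_sum_of_nonneg (fun _ => Nat.zero_le _)).trans hle, ?_⟩
          intro i hi
          rw [Finset.mem_erase]
          refine ⟨?_, Finset.mem_univ i⟩
          rintro rfl
          exact Finsupp.mem_support_iff.1 hi hβ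
        exact congrFun hΘ ⟨β, hβT⟩
      · exact hea β (by rw [weight_one_eq]; omega)
    obtain ⟨b, hb⟩ := hdvd a g hg
    refine ⟨b, ?_, hb.symm⟩
    by_cases hb0 : b = 0
    · rw [hb0]; exact Submodule.zero_mem _
    · obtain ⟨f, hf, hf'⟩ := exists_mem_afilt_of_ne_zero (fun _ => 1) hb0
      refine afilt_mono _ ?_ hf
      -- Degrees add: deg b + E = deg a ≤ N + E.
      by_contra hlt
      refine hL f b hf hf' ?_
      rw [← hb]
      exact afilt_mono _ (by omega) ha
  -- With s = 2n + m, rank–nullity gives C(s+N+E, N+E) ≤ C(s+N, N) + C(s-1+M, M) for M = d(N+E).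
  have h1 := finrank_le_finrank_ker_add_card V Θ
  have h3 := (Submodule.finrank_mono hker).trans (Submodule.finrank_map_le _ _)
  rw [finrank_afilt] at h1 h3
  rw [Fintype.card_coe, card_exps, Finset.card_erase_of_mem (Finset.mem_univ j), Finset.card_univ,
    card_idx] at h1
  omega

end DegreeBound

/-! ### The three implications. -/

section Main

variable {K : Type*} [Field K] {n m : ℕ}

theorem innerPartial_id_symb (i : Fin n ⊕ Fin n) (a : Alg K n m) :
    symb K n m (innerPartial (AlgHom.id K _) i a)
      = MvPolynomial.pderiv (inner i) (symb K n m a) := by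
  conv_lhs => rw [← normalOrder_symb a]
  rcases i with i | i
  · exact (congrArg _ (ad_p_normalOrder i _)).trans (symb_normalOrder _)
  · exact (congrArg _ (ad_q_normalOrder i _)).trans (symb_normalOrder _)

theorem pd_symb (l : Fin m) (a : Alg K n m) :
    symb K n m (pd K n m l a) = MvPolynomial.pderiv (iz l) (symb K n m a) := by
  conv_lhs => rw [← normalOrder_symb a]
  rw [pd_normalOrder, symb_normalOrder]

theorem innerPartial_id_mem_afilt (i : Fin n ⊕ Fin n) {a : Alg K n m} {d : ℕ}
    (ha : a ∈ afilt K n m (fun _ => 1) (d + 1)) :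
    innerPartial (AlgHom.id K _) i a ∈ afilt K n m (fun _ => 1) d := by
  rw [mem_afilt, innerPartial_id_symb]
  exact pderiv_mem_filt (w := fun _ => 1) Nat.one_pos ha

theorem pd_mem_afilt (l : Fin m) {a : Alg K n m} {d : ℕ}
    (ha : a ∈ afilt K n m (fun _ => 1) (d + 1)) :
    pd K n m l a ∈ afilt K n m (fun _ => 1) d := by
  rw [mem_afilt, pd_symb]
  exact pderiv_mem_filt (w := fun _ => 1) Nat.one_pos ha

theorem pow_apply_eq_zero_of_mem_afilt {δ : Alg K n m →ₗ[K] Alg K n m}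
    (hδ : ∀ (d : ℕ) (a : Alg K n m), a ∈ afilt K n m (fun _ => 1) (d + 1) →
      δ a ∈ afilt K n m (fun _ => 1) d) (d : ℕ) :
    ∀ a ∈ afilt K n m (fun _ => 1) d, (δ ^ d) a = 0 := by
  induction d with
  | zero => exact fun a ha => eq_zero_of_mem_afilt_zero ha
  | succ d ih => exact fun a ha => by rw [pow_succ, Module.End.mul_apply, ih _ (hδ d a ha)]

/-- An element lies in the filtration piece given by its degree. -/
theorem mem_afilt_deg (a : Alg K n m) : a ∈ afilt K n m (fun _ => 1) (deg a + 1) := by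
  -- `sInf` of the empty set is 0, so `deg` is attained only once the monomials are known to span.
  have hne : {d : ℕ | ∃ c : (Idx n m → ℕ) →₀ K, (c.sum fun α k => k • mono K n m α) = a ∧
      ∀ α ∈ c.support, ∑ i, α i ≤ d}.Nonempty := by
    have ha : a ∈ Submodule.span K (Set.range (mono K n m)) := by
      rw [span_mono_eq_top]; exact Submodule.mem_top
    obtain ⟨c, hc⟩ := Finsupp.mem_span_range_iff_exists_finsupp.1 ha
    exact ⟨c.support.sup fun α => ∑ i, α i, c, hc, fun α hα =>
      Finset.le_sup (f := fun α : Idx n m → ℕ => ∑ i, α i) hα⟩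
  obtain ⟨c, hc, hle⟩ := Nat.sInf_mem hne
  change ∀ α ∈ c.support, ∑ i, α i ≤ deg a at hle
  have hsum : (c.sum fun α k => k • mono K n m α) ∈ afilt K n m (fun _ => 1) (deg a + 1) := by
    refine Submodule.sum_mem _ fun α hα => Submodule.smul_mem _ _ ?_
    have := symb_mono (K := K) (Finsupp.equivFunOnFinite.symm α)
    rw [Finsupp.coe_equivFunOnFinite_symm] at this
    rw [mem_afilt, this]
    refine monomial_mem_filt ?_ 1
    classical
    rw [weight_one_eq]
    exact Nat.lt_succ_of_le (hle α hα)
  rwa [hc] at hsum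

theorem map_x_mem_afilt_degEnd (σ : Alg K n m →ₐ[K] Alg K n m) (i : Idx n m) :
    σ (x K n m i) ∈ afilt K n m (fun _ => 1) (degEnd σ + 1) :=
  afilt_mono _ (Nat.succ_le_succ (Finset.le_sup (f := fun i => deg (σ (x K n m i)))
    (Finset.mem_univ i))) (mem_afilt_deg _)

variable {σ : Alg K n m →ₐ[K] Alg K n m} {Δ : Kˣ}

variable (σ Δ) in
theorem partial'_inner (i : Fin n ⊕ Fin n) : partial' σ Δ (inner i) = innerPartial σ i := by
  rcases i with i | i <;> rfl

theorem innerPartial_pow_map (σ : Alg K n m →ₐ[K] Alg K n m) (i : Fin n ⊕ Fin n) (k : ℕ)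
    (a : Alg K n m) :
    (innerPartial σ i ^ k) (σ a) = σ ((innerPartial (AlgHom.id K _) i ^ k) a) := by
  induction k generalizing a with
  | zero => rfl
  | succ k ih =>
    rw [pow_succ, pow_succ, Module.End.mul_apply, Module.End.mul_apply, innerPartial_map, ih]

variable [CharZero K]

theorem isLocallyNilpotent_of_pow_x_eq_zero {k : ℕ}
    (h : ∀ i j : Idx n m, (partial' σ Δ i ^ k) (x K n m j) = 0) (i : Idx n m) :
    IsLocallyNilpotent (partial' σ Δ i) :=
  (isDer_partial' σ Δ i).isLocallyNilpotent adjoin_x_eq_top (by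
    rintro _ ⟨j, rfl⟩
    exact ⟨k, h i j⟩)

theorem dualDer_pow_cenEnd (hΔ : ldet (jac σ) = algebraMap K (Alg K n m) (Δ : K)) (j : Fin m)
    (k : ℕ) (f : MvPolynomial (Fin m) K) :
    ((dualDer (fun k => cenEnd σ (MvPolynomial.X k)) Δ j).toLinearMap ^ k) (cenEnd σ f)
      = cenEnd σ (((MvPolynomial.pderiv (R := K) j).toLinearMap ^ k) f) := by
  induction k generalizing f with
  | zero => rfl
  | succ k ih =>
    rw [pow_succ, pow_succ, Module.End.mul_apply, Module.End.mul_apply, ← ih]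
    congr 1
    exact dualDer_algHom (cenEnd σ) (polyJac_cenEnd_det hΔ) j f

omit [CharZero K] in
theorem pd_pow_cen (l : Fin m) (k : ℕ) (f : MvPolynomial (Fin m) K) :
    (pd K n m l ^ k) (cen K n m f)
      = cen K n m (((MvPolynomial.pderiv (R := K) l).toLinearMap ^ k) f) := by
  induction k generalizing f with
  | zero => rfl
  | succ k ih =>
    rw [pow_succ, pow_succ, Module.End.mul_apply, Module.End.mul_apply, ← ih]
    rfl

/-- Conjugation by σ turns the power of ∂'_i at x_j into a power of a standard derivation at
σ⁻¹(x_j). That element has degree at most k = (deg σ)^{s-1}, so k + 1 applications kill it. -/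
theorem pow_x_eq_zero_of_equiv (hΔ : ldet (jac σ) = algebraMap K (Alg K n m) (Δ : K))
    (e : Alg K n m ≃ₐ[K] Alg K n m) (he : ∀ a, e a = σ a) (i j : Idx n m) :
    (partial' σ Δ i ^ (degEnd σ ^ (2 * n + m - 1) + 1)) (x K n m j) = 0 := by
  have hdeg := symm_x_mem_afilt e (d := degEnd σ)
    (fun i => by rw [he]; exact map_x_mem_afilt_degEnd σ i) j
  generalize degEnd σ ^ (2 * n + m - 1) = k at hdeg ⊢
  have hinner : ∀ i : Fin n ⊕ Fin n, (innerPartial σ i ^ (k + 1)) (x K n m j) = 0 := by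
    intro i
    rw [← e.apply_symm_apply (x K n m j), he, innerPartial_pow_map,
      pow_apply_eq_zero_of_mem_afilt (fun d a ha => innerPartial_id_mem_afilt i ha) _ _ hdeg,
      map_zero]
  rcases i with i | i | l
  · exact hinner (Sum.inl i)
  · exact hinner (Sum.inr i)
  -- The central derivations are conjugate to `pd` only on the centre. On A_n they vanish outright,
  -- which settles the generators q_i and p_i.
  have hweyl : ∀ w : Weyl K n, (centralPartial σ Δ l ^ (k + 1)) (weylIncl K n m w) = 0 := by
    intro w
    have h := centralPartial_weyl_mul_cen σ Δ l w 1
    rw [map_one, mul_one, Derivation.map_one_eq_zero, map_zero, mul_zero] at h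
    rw [pow_succ, Module.End.mul_apply, h, map_zero]
  rcases j with j | j | t
  · exact hweyl (Weyl.q K n j)
  · exact hweyl (Weyl.p K n j)
  -- The inverse is also an endomorphism, so it preserves the centre and the computation stays in
  -- P_m.
  obtain ⟨g, hg⟩ := exists_cen_eq_map_cen (e.symm : Alg K n m →ₐ[K] Alg K n m) (MvPolynomial.X t)
  have hg' : cen K n m g = e.symm (x K n m (iz t)) := hg
  rw [← hg'] at hdeg
  have hx : x K n m (iz t) = cen K n m (cenEnd σ g) := by
    rw [cen_cenEnd, hg', ← he, AlgEquiv.apply_symm_apply]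
  have h0 := pow_apply_eq_zero_of_mem_afilt (fun d a ha => pd_mem_afilt l ha) _ _ hdeg
  rw [pd_pow_cen, ← map_zero (cen K n m)] at h0
  change (centralPartial σ Δ l ^ (k + 1)) _ = 0
  rw [hx, centralPartial_pow_cen, dualDer_pow_cenEnd hΔ, cen_injective h0, map_zero, map_zero]

/-- Slices are used twice: on P_m, where the constants are K, and then on A with only the inner
derivations, whose constants P_m already lie in the image. -/
theorem surjective_of_isLocallyNilpotent_partial'
    (hΔ : ldet (jac σ) = algebraMap K (Alg K n m) (Δ : K))
    (h : ∀ i : Idx n m, IsLocallyNilpotent (partial' σ Δ i)) : Function.Surjective σ := by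
  have hcen : Function.Surjective (cenEnd σ) := by
    refine surjective_of_isLocallyNilpotent (cenEnd σ) (polyJac_cenEnd_det hΔ) fun j f => ?_
    obtain ⟨k, hk⟩ := h (iz j) (cen K n m f)
    refine ⟨k, cen_injective (n := n) ?_⟩
    rw [map_zero, ← centralPartial_pow_cen]
    exact hk
  intro a
  refine mem_of_slices (innerPartial σ) (isDer_innerPartial σ) (innerPartial_comm σ)
    (fun i => by rw [← partial'_inner σ Δ]; exact h _) (fun i => σ (x K n m (inner i)))
    (innerPartial_x σ) σ.range (fun i => ⟨_, rfl⟩) (fun b hb => ?_) a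
  obtain ⟨f, rfl⟩ := exists_cen_eq_of_commute σ hb
  obtain ⟨g, rfl⟩ := hcen f
  exact ⟨cen K n m g, (cen_cenEnd σ g).symm⟩

/-- The kernel is stable under the standard inner derivations, which lower degree; by induction they
kill a, so a is central. The chain rule on P_m then makes its gradient vanish, and σ fixes
constants. -/
theorem injective_of_jacobian (hΔ : ldet (jac σ) = algebraMap K (Alg K n m) (Δ : K)) :
    Function.Injective σ := by
  have key : ∀ (d : ℕ), ∀ a ∈ afilt K n m (fun _ => 1) d, σ a = 0 → a = 0 := by
    intro d
    induction d with
    | zero => exact fun a ha _ => eq_zero_of_mem_afilt_zero ha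
    | succ d ih =>
      intro a ha h0
      obtain ⟨f, rfl⟩ := exists_cen_eq_of_commute (AlgHom.id K _) (c := a) fun i =>
        ih _ (innerPartial_id_mem_afilt i ha) (by rw [← innerPartial_map, h0, map_zero])
      have hf : cenEnd σ f = 0 := cen_injective (n := n) (by rw [cen_cenEnd, h0, map_zero])
      have hpd : ∀ l, MvPolynomial.pderiv l f = 0 := by
        intro l
        apply cen_injective (n := n)
        rw [map_zero]
        refine ih _ ?_ ?_
        · rw [← pd_cen]; exact pd_mem_afilt l ha
        · rw [← cen_cenEnd, ← dualDer_algHom (cenEnd σ) (polyJac_cenEnd_det hΔ), hf, map_zero,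
            map_zero]
      rw [eq_C_of_pderiv_eq_zero f hpd, ← MvPolynomial.algebraMap_eq, AlgHom.commutes] at h0 ⊢
      rwa [AlgHom.commutes] at h0
  refine (injective_iff_map_eq_zero σ).2 fun a ha => ?_
  obtain ⟨d, hd⟩ := exists_mem_afilt a
  exact key d a hd ha

end Main

end WeylPoly

theorem theorem5p8 {K : Type*} [Field K] [CharZero K] (n m : ℕ)
    (σ : WeylPoly.Alg K n m →ₐ[K] WeylPoly.Alg K n m) (Δ : Kˣ)
    (hΔ : WeylPoly.ldet (WeylPoly.jac σ) = algebraMap K (WeylPoly.Alg K n m) (Δ : K)) :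
    ((∃ e : WeylPoly.Alg K n m ≃ₐ[K] WeylPoly.Alg K n m, ∀ a, e a = σ a) ↔
        ∀ i : WeylPoly.Idx n m, WeylPoly.IsLocallyNilpotent (WeylPoly.partial' σ Δ i)) ∧
      ((∀ i : WeylPoly.Idx n m, WeylPoly.IsLocallyNilpotent (WeylPoly.partial' σ Δ i)) ↔
        ∀ i j : WeylPoly.Idx n m,
          (WeylPoly.partial' σ Δ i ^ (WeylPoly.degEnd σ ^ (2 * n + m - 1) + 1))
            (WeylPoly.x K n m j) = 0) := by
  have h13 : (∃ e : WeylPoly.Alg K n m ≃ₐ[K] WeylPoly.Alg K n m, ∀ a, e a = σ a) →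
      ∀ i j : WeylPoly.Idx n m,
        (WeylPoly.partial' σ Δ i ^ (WeylPoly.degEnd σ ^ (2 * n + m - 1) + 1))
          (WeylPoly.x K n m j) = 0 :=
    fun ⟨e, he⟩ => WeylPoly.pow_x_eq_zero_of_equiv hΔ e he
  have h21 : (∀ i : WeylPoly.Idx n m, WeylPoly.IsLocallyNilpotent (WeylPoly.partial' σ Δ i)) →
      ∃ e : WeylPoly.Alg K n m ≃ₐ[K] WeylPoly.Alg K n m, ∀ a, e a = σ a := fun h =>
    ⟨AlgEquiv.ofBijective σ ⟨WeylPoly.injective_of_jacobian hΔ,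
      WeylPoly.surjective_of_isLocallyNilpotent_partial' hΔ h⟩, fun _ => rfl⟩
  exact ⟨⟨fun h => WeylPoly.isLocallyNilpotent_of_pow_x_eq_zero (h13 h), h21⟩,
    ⟨fun h => h13 (h21 h), WeylPoly.isLocallyNilpotent_of_pow_x_eq_zero⟩⟩
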